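/- Let $\mathbb K=\mathbb R$ or $\mathbb C$. For a nilpotent Lie algebra $\mathfrak g$ over $\mathbb K$ and $X\in\mathfrak g$, let $c(X)$ be the decreasing sequence of the sizes of the Jordan blocks of the nilpotent operator $\operatorname{ad}X$; the characteristic sequence of $\mathfrak g$ is $c(\mathfrak g)=\max\{c(X): X\in\mathfrak g\setminus[\mathfrak g,\mathfrak g]\}$ for the lexicographic order. A symplectic form on $\mathfrak g$ is a nondegenerate alternating bilinear form $\theta$ on $\mathfrak g$ with $\theta([X,Y],Z)+\theta([Y,Z],X)+\theta([Z,X],Y)=0$ for all $X,Y,Z\in\mathfrak g$, and $\mathfrak g$ is called symplectic if it admits such a form. For $\alpha\in\mathfrak g^*$ put $d\alpha(X,Y)=-\alpha([X,Y])$. **Theorem.** Let $\mathfrak g$ be an $8$-dimensional $2$-step nilpotent Lie algebra over $\mathbb K$ (that is, $[\mathfrak g,\mathfrak g]\neq 0$ and $[\mathfrak g,[\mathfrak g,\mathfrak g]]=0$) whose characteristic sequence is $(2,2,2,1,1)$. Then $\mathfrak g$ is symplectic if and only if it is not isomorphic to the $8$-dimensional Lie algebra over $\mathbb K$ whose Maurer–Cartan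 equations, in the basis $\alpha_1,\dots,\alpha_8$ dual to some basis of the algebra, are $$d\alpha_3=-\alpha_1\wedge\alpha_2,\qquad d\alpha_5=-\alpha_1\wedge\alpha_4,\qquad d\alpha_7=-\alpha_1\wedge\alpha_6-\alpha_2\wedge\alpha_4-\alpha_6\wedge\alpha_8,$$ $$d\alpha_i=0\quad (i=1,2,4,6,8).$$ -/

import Mathlib

/-- `LieAlgebra.IsStepNilpotent K L k`: the nilindex of `L` is `k`, that is, `k` is the smallest
index at which the lower central series `C⁰(L) = L`, `Cʲ(L) = [L, Cʲ⁻¹(L)]` vanishes. -/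
def LieAlgebra.IsStepNilpotent (K L : Type*) [CommRing K] [LieRing L] [LieAlgebra K L]
    (k : ℕ) : Prop :=
  LieModule.lowerCentralSeries K L L k = ⊥ ∧
    ∀ j < k, LieModule.lowerCentralSeries K L L j ≠ ⊥

/-- `T` is nilpotent and `l` is the decreasing list of the sizes of its Jordan blocks: there is a
basis made of chains `b i 0 ↦ b i 1 ↦ ⋯ ↦ b i (lᵢ - 1) ↦ 0`, the `i`-th of length `lᵢ`. -/
def LinearMap.HasNilpotentJordanType {K V : Type*} [Field K] [AddCommGroup V] [Module K V]
    (T : V →ₗ[K] V) (l : List ℕ) : Prop :=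
  l.SortedGE ∧ (∀ n ∈ l, 0 < n) ∧
    ∃ b : Module.Basis (Σ i : Fin l.length, Fin (l.get i)) K V,
      ∀ (i : Fin l.length) (j : Fin (l.get i)),
        T (b ⟨i, j⟩) = if h : (j : ℕ) + 1 < l.get i then b ⟨i, ⟨(j : ℕ) + 1, h⟩⟩ else 0

/-- `c` is the characteristic sequence of the nilpotent Lie algebra `L`: the maximum, for the
lexicographic order, of the Jordan block sizes of `ad X` over all `X ∈ L` outside `[L, L]`. -/
def LieAlgebra.IsCharacteristicSequence (K L : Type*) [Field K] [LieRing L] [LieAlgebra K L]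
    (c : List ℕ) : Prop :=
  IsGreatest {l : List ℕ | ∃ X : L, X ∉ LieModule.lowerCentralSeries K L L 1 ∧
    (LieAlgebra.ad K L X).HasNilpotentJordanType l} c

/-- A symplectic form on a Lie algebra: an alternating, closed, nondegenerate bilinear form. -/
structure LieAlgebra.IsSymplecticForm {K L : Type*} [Field K] [LieRing L] [LieAlgebra K L]
    (θ : LinearMap.BilinForm K L) : Prop where
  alt : θ.IsAlt
  closed : ∀ X Y Z : L, θ ⁅X, Y⁆ Z + θ ⁅Y, Z⁆ X + θ ⁅Z, X⁆ Y = 0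
  nondegenerate : θ.Nondegenerate

/-- A Lie algebra is symplectic if it admits a symplectic form. -/
def LieAlgebra.IsSymplectic (K L : Type*) [Field K] [LieRing L] [LieAlgebra K L] : Prop :=
  ∃ θ : LinearMap.BilinForm K L, LieAlgebra.IsSymplecticForm θ

/-- The vector space `K⁸`, which carries the Lie bracket with Maurer-Cartan equations
`dα₃ = -α₁∧α₂`, `dα₅ = -α₁∧α₄`, `dα₇ = -α₁∧α₆ - α₂∧α₄ - α₆∧α₈`, and `dαᵢ = 0` otherwise.
The form `αᵢ` is the coordinate of index `i - 1`. -/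
def ExceptionalAlgebra (K : Type*) : Type _ := Fin 8 → K

namespace ExceptionalAlgebra

instance (K : Type*) [Field K] : AddCommGroup (ExceptionalAlgebra K) :=
  inferInstanceAs (AddCommGroup (Fin 8 → K))

instance (K : Type*) [Field K] : Module K (ExceptionalAlgebra K) :=
  inferInstanceAs (Module K (Fin 8 → K))

/-- The linear forms `α₁, …, α₈` of the dual basis. -/
def coord (K : Type*) [Field K] (i : ℕ) (hi : 1 ≤ i ∧ i ≤ 8 := by decide) :
    Module.Dual K (ExceptionalAlgebra K) :=
  LinearMap.proj (R := K) (φ := fun _ : Fin 8 => K) ⟨i - 1, by omega⟩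

/-- The bracket is determined by `α [x, y] = -dα (x, y)`. -/
instance (K : Type*) [Field K] : Bracket (ExceptionalAlgebra K) (ExceptionalAlgebra K) where
  bracket x y :=
    ![0, 0,
      x 0 * y 1 - x 1 * y 0,
      0,
      x 0 * y 3 - x 3 * y 0,
      0,
      (x 0 * y 5 - x 5 * y 0) + (x 1 * y 3 - x 3 * y 1) + (x 5 * y 7 - x 7 * y 5),
      0]

theorem bracket_apply {K : Type*} [Field K] (x y : ExceptionalAlgebra K) (i : Fin 8) :
    ⁅x, y⁆ i = (![0, 0,
      x 0 * y 1 - x 1 * y 0,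
      0,
      x 0 * y 3 - x 3 * y 0,
      0,
      (x 0 * y 5 - x 5 * y 0) + (x 1 * y 3 - x 3 * y 1) + (x 5 * y 7 - x 7 * y 5),
      0] : Fin 8 → K) i := rfl

theorem add_apply {K : Type*} [Field K] (x y : ExceptionalAlgebra K) (i : Fin 8) :
    (x + y) i = x i + y i := rfl

theorem smul_apply {K : Type*} [Field K] (c : K) (x : ExceptionalAlgebra K) (i : Fin 8) :
    (c • x) i = c * x i := rfl

theorem zero_apply {K : Type*} [Field K] (i : Fin 8) :
    (0 : ExceptionalAlgebra K) i = 0 := rfl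

instance (K : Type*) [Field K] : LieRing (ExceptionalAlgebra K) where
  add_lie x y z := by
    funext i
    fin_cases i <;> simp [bracket_apply, add_apply] <;> ring
  lie_add x y z := by
    funext i
    fin_cases i <;> simp [bracket_apply, add_apply] <;> ring
  lie_self x := by
    funext i
    fin_cases i <;> simp [bracket_apply, zero_apply] <;> ring
  leibniz_lie x y z := by
    funext i
    fin_cases i <;> simp [bracket_apply, add_apply]

instance (K : Type*) [Field K] : LieAlgebra K (ExceptionalAlgebra K) where
  lie_smul c x y := by
    funext i
    fin_cases i <;> simp [bracket_apply, smul_apply] <;> ring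

theorem coord_apply {K : Type*} [Field K] (i : ℕ) (hi : 1 ≤ i ∧ i ≤ 8)
    (x : ExceptionalAlgebra K) : coord K i hi x = x ⟨i - 1, by omega⟩ := rfl

/-- The Maurer-Cartan equations, with `dα (x, y) = -α [x, y]` and
`(α ∧ β) (x, y) = α x * β y - α y * β x`. -/
theorem maurerCartan {K : Type*} [Field K] (x y : ExceptionalAlgebra K) :
    let d (α : Module.Dual K (ExceptionalAlgebra K)) : K := -α ⁅x, y⁆
    let w (α β : Module.Dual K (ExceptionalAlgebra K)) : K := α x * β y - α y * β x
    d (coord K 3) = -w (coord K 1) (coord K 2) ∧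
    d (coord K 5) = -w (coord K 1) (coord K 4) ∧
    d (coord K 7) = -w (coord K 1) (coord K 6) - w (coord K 2) (coord K 4)
      - w (coord K 6) (coord K 8) ∧
    d (coord K 1) = 0 ∧ d (coord K 2) = 0 ∧ d (coord K 4) = 0 ∧ d (coord K 6) = 0 ∧
    d (coord K 8) = 0 := by
  refine ⟨?_, ?_, ?_, ?_, ?_, ?_, ?_, ?_⟩ <;> simp [coord_apply, bracket_apply] <;> ring

end ExceptionalAlgebra

/-!
A `2`-step nilpotent Lie algebra is an extension of an abelian algebra `V` by a central subspace
`E` containing all brackets. A closed `2`-form on it restricts to a pairing `β : E → V*` and is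
otherwise arbitrary on `V`, so in even dimension a symplectic form exists as soon as some
injective `β` is closed.

The Jordan type says that some `ad x` has rank `3`. If not every bracket lies in the range of
`ad x`, the remaining closedness equations are solved by an invertible matrix. Otherwise the algebra
is encoded by two `3 × 3` matrices: `Q`, through which an element `w` commuting with `x` acts, and
`P`, which gives the remaining brackets as `P (a ⨯₃ b)`. Replacing `w` by `w + r • x` shifts `Q`
by a scalar, which leaves few normal forms. The closedness equations can be solved injectively for
all of them except when `Q` has rank one, is not nilpotent, and `P` is special; this is the
exceptional algebra, where one bracket lies in the radical of every closed form.
-/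

open Module Matrix

section SymplecticForms

variable {K : Type*} [Field K]

/-- The alternating form `(x, y) ↦ ⟨p x, y⟩ - ⟨p y, x⟩` attached to a linear map `p : V → F` and a
pairing `q` of `F` with `V`. In coordinates it is `∑ pᵢ ∧ qᵢ`, so its nondegeneracy can be read off
the common kernel of `p` and `q`. -/
def skewPairing {V F : Type*} [AddCommGroup V] [Module K V] [AddCommGroup F] [Module K F]
    (p : V →ₗ[K] F) (q : F →ₗ[K] Dual K V) : LinearMap.BilinForm K V :=
  q ∘ₗ p - (q ∘ₗ p).flip

namespace skewPairing

variable {V F : Type*} [AddCommGroup V] [Module K V] [AddCommGroup F] [Module K F]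

theorem apply_apply (p : V →ₗ[K] F) (q : F →ₗ[K] Dual K V) (x y : V) :
    skewPairing p q x y = q (p x) y - q (p y) x :=
  rfl

theorem isAlt (p : V →ₗ[K] F) (q : F →ₗ[K] Dual K V) : (skewPairing p q).IsAlt :=
  fun _ => sub_self _

theorem nondegenerate [FiniteDimensional K V] [FiniteDimensional K F] {p : V →ₗ[K] F}
    {q : F →ₗ[K] Dual K V} (hdim : finrank K V = 2 * finrank K F)
    (hker : ∀ x, p x = 0 → q.flip x = 0 → x = 0) : (skewPairing p q).Nondegenerate := by
  have hinj : Function.Injective (p.prod q.flip) :=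
    (injective_iff_map_eq_zero _).2 fun x hx => hker x (congrArg Prod.fst hx) (congrArg Prod.snd hx)
  have hsurj : Function.Surjective (p.prod q.flip) := by
    refine (LinearMap.injective_iff_surjective_of_finrank_eq_finrank ?_).1 hinj
    rw [finrank_prod, Subspace.dual_finrank_eq, hdim, two_mul]
  have hleft (x : V) (hx : ∀ y, skewPairing p q x y = 0) : x = 0 := by
    have hx' (y : V) : q (p x) y = q (p y) x := sub_eq_zero.1 (hx y)
    have hpx : p x = 0 := by
      refine (forall_dual_apply_eq_zero_iff K _).1 fun φ => ?_
      obtain ⟨y, hy⟩ := hsurj (0, φ)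
      have hpy : p y = 0 := congrArg Prod.fst hy
      have hqy : q.flip y = φ := congrArg Prod.snd hy
      rw [← hqy, LinearMap.flip_apply, hx', hpy, map_zero, LinearMap.zero_apply]
    refine hker x hpx (LinearMap.ext fun f => ?_)
    obtain ⟨y, hy⟩ := hsurj (f, 0)
    have hpy : p y = f := congrArg Prod.fst hy
    rw [LinearMap.flip_apply, ← hpy, ← hx', hpx, map_zero, LinearMap.zero_apply,
      LinearMap.zero_apply]
  exact ⟨hleft, fun y hy => hleft y fun x => by
    rw [← LinearMap.IsAlt.neg (isAlt p q), hy, neg_zero]⟩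

end skewPairing

theorem exists_skewPairing_completion {V E : Type*} [AddCommGroup V] [Module K V]
    [FiniteDimensional K V] [AddCommGroup E] [Module K E] [FiniteDimensional K E]
    {β : E →ₗ[K] Dual K V} (hβ : Function.Injective β)
    (heven : Even (finrank K V + finrank K E)) :
    ∃ (k : ℕ) (p : V →ₗ[K] Fin k → K) (q : (Fin k → K) →ₗ[K] Dual K V),
      finrank K V = finrank K E + 2 * k ∧
        ∀ v, β.flip v = 0 → p v = 0 → q.flip v = 0 → v = 0 := by
  have hrange : finrank K (LinearMap.range β.flip) = finrank K E := by
    rw [LinearMap.range_eq_top.2 (LinearMap.flip_surjective_iff₁.2 hβ), finrank_top,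
      Subspace.dual_finrank_eq]
  have hrank := LinearMap.finrank_range_add_finrank_ker β.flip
  obtain ⟨k, hk⟩ : ∃ k, finrank K (LinearMap.ker β.flip) = k + k := by
    rw [← hrank, hrange, add_right_comm] at heven
    exact (Nat.even_add.1 heven).1 ⟨_, rfl⟩
  have e : LinearMap.ker β.flip ≃ₗ[K] (Fin k → K) × Dual K (Fin k → K) :=
    LinearEquiv.ofFinrankEq _ _ (by
      rw [finrank_prod, Subspace.dual_finrank_eq, finrank_fin_fun, hk])
  obtain ⟨ψ, hψ⟩ := LinearMap.exists_extend e.toLinearMap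
  refine ⟨k, LinearMap.fst K _ _ ∘ₗ ψ, (LinearMap.snd K _ _ ∘ₗ ψ).flip, by omega,
    fun v hv hp hq => ?_⟩
  have hev : e ⟨v, hv⟩ = 0 := by
    have : ψ v = e ⟨v, hv⟩ := LinearMap.congr_fun hψ ⟨v, hv⟩
    exact this ▸ Prod.ext hp hq
  exact congrArg Subtype.val (e.map_eq_zero_iff.1 hev)

end SymplecticForms

section Symplectic

variable {K L : Type*} [Field K] [LieRing L] [LieAlgebra K L]

theorem isSymplectic_of_lieEquiv {L' : Type*} [LieRing L'] [LieAlgebra K L']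
    (φ : L ≃ₗ⁅K⁆ L') (h : LieAlgebra.IsSymplectic K L) : LieAlgebra.IsSymplectic K L' := by
  obtain ⟨θ, hθ⟩ := h
  refine ⟨θ.congr φ.toLinearEquiv, fun x => hθ.alt _, fun X Y Z => ?_,
    hθ.nondegenerate.congr φ.toLinearEquiv⟩
  change θ (φ.symm ⁅X, Y⁆) (φ.symm Z) + θ (φ.symm ⁅Y, Z⁆) (φ.symm X)
    + θ (φ.symm ⁅Z, X⁆) (φ.symm Y) = 0
  simpa only [LieEquiv.map_lie] using hθ.closed (φ.symm X) (φ.symm Y) (φ.symm Z)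

theorem isSymplecticForm_lie_apply_eq_zero {θ : LinearMap.BilinForm K L}
    (hθ : LieAlgebra.IsSymplecticForm θ) {X Y Z : L} (hX : ⁅X, Z⁆ = 0) (hY : ⁅Y, Z⁆ = 0) :
    θ ⁅X, Y⁆ Z = 0 := by
  simpa [hY, ← lie_skew Z X, hX] using hθ.closed X Y Z

/-- `L` is an extension of the abelian Lie algebra `V` by the central subspace `E`, with cocycle
`c`: up to a linear identification `L = V × E`, the bracket of `(u, d)` and `(v, d')` is
`(0, c u v)`. -/
def IsCentralExtensionBy (K L : Type*) [Field K] [LieRing L] [LieAlgebra K L] {V E : Type*}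
    [AddCommGroup V] [Module K V] [AddCommGroup E] [Module K E] (c : V → V → E) : Prop :=
  ∃ Φ : L ≃ₗ[K] V × E, ∀ X Y, Φ ⁅X, Y⁆ = (0, c (Φ X).1 (Φ Y).1)

namespace IsCentralExtensionBy

variable {V E : Type*} [AddCommGroup V] [Module K V] [FiniteDimensional K V] [AddCommGroup E]
  [Module K E] [FiniteDimensional K E] {c : V → V → E}

theorem of_lie_eq (σ : V →ₗ[K] L) (ι : E →ₗ[K] L) (hι : ∀ (X : L) d, ⁅X, ι d⁆ = 0)
    (hσ : ∀ u v, ⁅σ u, σ v⁆ = ι (c u v)) (hinj : ∀ u d, σ u + ι d = 0 → u = 0 ∧ d = 0)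
    (hdim : finrank K L = finrank K V + finrank K E) [FiniteDimensional K L] :
    IsCentralExtensionBy K L c := by
  have hker : Function.Injective (σ.coprod ι) :=
    (injective_iff_map_eq_zero _).2 fun x hx => Prod.ext_iff.2 (hinj x.1 x.2 hx)
  let Ψ : (V × E) ≃ₗ[K] L := LinearEquiv.ofInjectiveOfFinrankEq (σ.coprod ι) hker (by
    rw [finrank_prod, hdim])
  have hΨ (x : V × E) : Ψ x = σ x.1 + ι x.2 := rfl
  refine ⟨Ψ.symm, fun X Y => Ψ.symm_apply_eq.2 ?_⟩
  obtain ⟨x, rfl⟩ := Ψ.surjective X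
  obtain ⟨y, rfl⟩ := Ψ.surjective Y
  have hι' (Z : L) (d : E) : ⁅ι d, Z⁆ = 0 := by rw [← lie_skew, hι, neg_zero]
  simp only [Ψ.symm_apply_apply]
  simp only [hΨ, lie_add, add_lie, hι, hι', hσ, map_zero, add_zero, zero_add]

/-- A closed form is determined on `D ⊗ L` by `β`, where `D` is the image of `E` in `L`, and may be
modified by an arbitrary form on `V`. -/
theorem isSymplectic_of_injective (hc : IsCentralExtensionBy K L c)
    (hdim : Even (finrank K V + finrank K E)) {β : E →ₗ[K] Dual K V} (hβ : Function.Injective β)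
    (hclosed : ∀ u v w, β (c u v) w + β (c v w) u + β (c w u) v = 0) :
    LieAlgebra.IsSymplectic K L := by
  obtain ⟨Φ, hΦ⟩ := hc
  have hL : finrank K L = finrank K V + finrank K E := by rw [Φ.finrank_eq, finrank_prod]
  obtain ⟨k, p₀, q₀, hk, hker⟩ := exists_skewPairing_completion hβ hdim
  let π : L →ₗ[K] V := LinearMap.fst K V E ∘ₗ Φ
  let ζ : L →ₗ[K] E := LinearMap.snd K V E ∘ₗ Φ
  let p : L →ₗ[K] E × (Fin k → K) := ζ.prod (p₀ ∘ₗ π)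
  let q : E × (Fin k → K) →ₗ[K] Dual K L := π.dualMap ∘ₗ β.coprod q₀
  have hπ (X Y : L) : π ⁅X, Y⁆ = 0 := congrArg Prod.fst (hΦ X Y)
  have hζ (X Y : L) : ζ ⁅X, Y⁆ = c (π X) (π Y) := congrArg Prod.snd (hΦ X Y)
  have : FiniteDimensional K L := Φ.symm.finiteDimensional
  refine ⟨skewPairing p q, skewPairing.isAlt p q, fun X Y Z => ?_,
    skewPairing.nondegenerate ?_ fun x hp hq => ?_⟩
  · have hθ (X Y Z : L) : skewPairing p q ⁅X, Y⁆ Z = β (c (π X) (π Y)) (π Z) := by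
      simp [skewPairing.apply_apply, p, q, hπ, hζ]
    simpa only [hθ] using hclosed (π X) (π Y) (π Z)
  · rw [finrank_prod, finrank_fin_fun, hL]
    omega
  · have hqx (d : E) (a : Fin k → K) : β d (π x) + q₀ a (π x) = 0 :=
      LinearMap.congr_fun hq (d, a)
    have hβx : β.flip (π x) = 0 := LinearMap.ext fun d => by simpa using hqx d 0
    have hq₀x : q₀.flip (π x) = 0 := LinearMap.ext fun a => by simpa using hqx 0 a
    have hπx : π x = 0 := hker _ hβx (congrArg Prod.snd hp) hq₀x
    exact Φ.map_eq_zero_iff.1 (Prod.ext hπx (congrArg Prod.fst hp))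

end IsCentralExtensionBy

/-- The bracket `[e₀, e₅] = [e₁, e₃] = [e₅, e₇]` lies in the radical of every closed form. -/
theorem ExceptionalAlgebra.not_isSymplectic (K : Type*) [Field K] :
    ¬ LieAlgebra.IsSymplectic K (ExceptionalAlgebra K) := by
  rintro ⟨θ, hθ⟩
  let e (i : Fin 8) : ExceptionalAlgebra K := Pi.single (M := fun _ => K) i 1
  have ext {x y : ExceptionalAlgebra K} (h : ∀ i, x i = y i) : x = y := funext h
  have he (i j : Fin 8) : e i j = if j = i then 1 else 0 := Pi.single_apply i (1 : K) j
  have h13 : ⁅e 1, e 3⁆ = e 6 := ext fun i => by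
    fin_cases i <;> simp [bracket_apply, he]
  have h57 : ⁅e 5, e 7⁆ = e 6 := ext fun i => by
    fin_cases i <;> simp [bracket_apply, he]
  have h05 : ⁅e 0, e 5⁆ = e 6 := ext fun i => by
    fin_cases i <;> simp [bracket_apply, he]
  have h70 : ⁅e 7, e 0⁆ = 0 := ext fun i => by
    fin_cases i <;> simp [bracket_apply, he, zero_apply]
  have hcentralizer_13 {Z : ExceptionalAlgebra K} (h0 : Z 0 = 0) (h1 : Z 1 = 0) (h3 : Z 3 = 0) :
      θ (e 6) Z = 0 := by
    rw [← h13]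
    refine isSymplecticForm_lie_apply_eq_zero hθ ?_ ?_ <;>
      exact ext fun i => by fin_cases i <;> simp [bracket_apply, he, zero_apply, h0, h1, h3]
  have hcentralizer_57 {Z : ExceptionalAlgebra K} (h0 : Z 0 = 0) (h5 : Z 5 = 0) (h7 : Z 7 = 0) :
      θ (e 6) Z = 0 := by
    rw [← h57]
    refine isSymplecticForm_lie_apply_eq_zero hθ ?_ ?_ <;>
      exact ext fun i => by fin_cases i <;> simp [bracket_apply, he, zero_apply, h0, h5, h7]
  have h0 : θ (e 6) (e 0) = 0 := by
    have h67 : θ (e 6) (e 7) = 0 := hcentralizer_13 (by simp [he]) (by simp [he]) (by simp [he])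
    simpa only [h57, h70, h05, h67, map_zero, LinearMap.zero_apply, add_zero] using
      hθ.closed (e 5) (e 7) (e 0)
  have hradical (Z : ExceptionalAlgebra K) : θ (e 6) Z = 0 := by
    obtain ⟨W, hW⟩ : ∃ W : ExceptionalAlgebra K,
        ∀ i, W i = (![0, 0, Z 2, 0, Z 4, Z 5, Z 6, Z 7] : Fin 8 → K) i := ⟨_, fun _ => rfl⟩
    have hZ : Z = Z 0 • e 0 + (Z 1 • e 1 + Z 3 • e 3) + W :=
      ext fun i => by fin_cases i <;> simp [add_apply, smul_apply, he, hW]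
    rw [hZ, map_add, map_add, map_smul, h0, hcentralizer_57, hcentralizer_13] <;>
      simp [add_apply, smul_apply, he, hW]
  have h6 : e 6 = 0 := hθ.nondegenerate.1 _ hradical
  simpa [he, zero_apply] using congrFun h6 6

end Symplectic

section CrossProduct

variable {R : Type*} [CommRing R]

/-- The axial vector of a `3 × 3` matrix `A`: the vector representing its antisymmetric part
through the cross product, see `dotProduct_mulVec_sub_dotProduct_mulVec`. -/
def axialVector (A : Matrix (Fin 3) (Fin 3) R) : Fin 3 → R :=
  ![A 1 2 - A 2 1, A 2 0 - A 0 2, A 0 1 - A 1 0]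

theorem dotProduct_mulVec_sub_dotProduct_mulVec (A : Matrix (Fin 3) (Fin 3) R)
    (u v : Fin 3 → R) : u ⬝ᵥ A *ᵥ v - v ⬝ᵥ A *ᵥ u = axialVector A ⬝ᵥ u ⨯₃ v := by
  simp only [dotProduct, mulVec, Fin.sum_univ_three, Fin.isValue, axialVector, cross_apply,
    Nat.succ_eq_add_one, Nat.reduceAdd, cons_val_zero, cons_val_one, cons_val]
  ring

theorem axialVector_eq_zero {A : Matrix (Fin 3) (Fin 3) R} (hA : A.IsSymm) :
    axialVector A = 0 := by
  simp [axialVector, hA.apply 1 2, hA.apply 0 2, hA.apply 0 1]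

theorem cyclic_sum_cross_dotProduct_mulVec (A : Matrix (Fin 3) (Fin 3) R)
    (u v w : Fin 3 → R) :
    u ⨯₃ v ⬝ᵥ A *ᵥ w + v ⨯₃ w ⬝ᵥ A *ᵥ u + w ⨯₃ u ⬝ᵥ A *ᵥ v = A.trace * (u ⬝ᵥ v ⨯₃ w) := by
  simp only [dotProduct, cross_apply, Nat.succ_eq_add_one, Nat.reduceAdd, Fin.isValue, mulVec,
    Fin.sum_univ_three, cons_val_zero, cons_val_one, cons_val, trace, diag_apply]
  ring

/-- `u ⨯₃ v` generates the second exterior power of `R³`, so alternating maps factor through it. -/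
theorem exists_eq_comp_cross {W F : Type*} [AddCommGroup W] [Module R W] [AddCommGroup F]
    [Module R F] {B : (Fin 3 → R) →ₗ[R] (Fin 3 → R) →ₗ[R] W} (hB : B.IsAlt) {ι : F →ₗ[R] W}
    (hι : ∀ u v, B u v ∈ LinearMap.range ι) :
    ∃ P : (Fin 3 → R) →ₗ[R] F, ∀ u v, B u v = ι (P (u ⨯₃ v)) := by
  let e : Basis (Fin 3) R (Fin 3 → R) := Pi.basisFun R (Fin 3)
  choose f hf using fun i : Fin 3 => hι (e (i + 1)) (e (i + 2))
  have hcross (i : Fin 3) : e (i + 1) ⨯₃ e (i + 2) = e i := by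
    ext j
    fin_cases i <;> fin_cases j <;> simp [e, cross_apply]
  let C := crossProduct.compr₂ (ι ∘ₗ e.constr R f)
  have hC : C.IsAlt := fun u => by simp [C]
  have hBC (i : Fin 3) : B (e (i + 1)) (e (i + 2)) = C (e (i + 1)) (e (i + 2)) := by
    simp [C, hcross, hf]
  have hCB (i : Fin 3) : B (e (i + 2)) (e (i + 1)) = C (e (i + 2)) (e (i + 1)) := by
    rw [← hB.neg, ← hC.neg, hBC]
  suffices hB_eq_C : B = C from ⟨e.constr R f, LinearMap.congr_fun₂ hB_eq_C⟩
  refine LinearMap.ext_basis e e fun i j => ?_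
  fin_cases i <;> fin_cases j
  · exact (hB _).trans (hC _).symm
  · exact hBC 2
  · exact hCB 1
  · exact hCB 2
  · exact (hB _).trans (hC _).symm
  · exact hBC 0
  · exact hBC 1
  · exact hCB 0
  · exact (hB _).trans (hC _).symm

end CrossProduct

section Cocycles

variable {K : Type*} [Field K]

/-- The cocycle on `K e ⊕ K f ⊕ K³` with values in `K³` for which `ad e` identifies the two copies
of `K³`, `-ad f` is `Q` and the brackets inside `K³` are `P (a ⨯₃ a')`. -/
def derivedThreeCocycle (P Q : Matrix (Fin 3) (Fin 3) K) (u v : K × K × (Fin 3 → K)) : Fin 3 → K :=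
  u.1 • v.2.2 - v.1 • u.2.2 + P *ᵥ (u.2.2 ⨯₃ v.2.2) + v.2.1 • Q *ᵥ u.2.2 - u.2.1 • Q *ᵥ v.2.2

/-- The cocycle on `K e ⊕ K³` with values in `K³ ⊕ K` for which `ad e` identifies the two copies
of `K³` and the brackets inside `K³` are `P (a ⨯₃ a')` and `p ⬝ᵥ a ⨯₃ a'`. -/
def derivedFourCocycle (P : Matrix (Fin 3) (Fin 3) K) (p : Fin 3 → K) (u v : K × (Fin 3 → K)) :
    (Fin 3 → K) × K :=
  (u.1 • v.2 - v.1 • u.2 + P *ᵥ (u.2 ⨯₃ v.2), p ⬝ᵥ u.2 ⨯₃ v.2)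

namespace IsCentralExtensionBy

variable {L : Type*} [LieRing L] [LieAlgebra K L] {P Q : Matrix (Fin 3) (Fin 3) K}

/-- The closed form pairs `d` with `(e, f, a)` to `(t ⬝ᵥ d) * e - (t ⬝ᵥ Q *ᵥ d) * f + d ⬝ᵥ M *ᵥ a`;
up to the choice of `t` and `M` this is forced by closedness. -/
theorem isSymplectic_of_axialVector_eq (hc : IsCentralExtensionBy K L (derivedThreeCocycle P Q))
    {t : Fin 3 → K} {M : Matrix (Fin 3) (Fin 3) K} (hM : axialVector M = -(t ᵥ* P))
    (hQM : axialVector (Qᵀ * M) = -(t ᵥ* (Q * P))) (htrace : (Pᵀ * M).trace = 0)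
    (hinj : ∀ d, t ⬝ᵥ d = 0 → t ⬝ᵥ Q *ᵥ d = 0 → d ᵥ* M = 0 → d = 0) :
    LieAlgebra.IsSymplectic K L := by
  let β : (Fin 3 → K) →ₗ[K] Dual K (K × K × (Fin 3 → K)) := LinearMap.mk₂ K
    (fun d u => (t ⬝ᵥ d) * u.1 - (t ⬝ᵥ Q *ᵥ d) * u.2.1 + d ⬝ᵥ M *ᵥ u.2.2)
    (fun d d' u => by simp only [dotProduct_add, add_dotProduct, mulVec_add]; ring)
    (fun r d u => by simp only [dotProduct_smul, smul_dotProduct, mulVec_smul, smul_eq_mul]; ring)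
    (fun d u v => by simp only [dotProduct_add, mulVec_add, Prod.fst_add, Prod.snd_add]; ring)
    (fun r d u => by
      simp only [dotProduct_smul, mulVec_smul, Prod.smul_fst, Prod.smul_snd, smul_eq_mul]; ring)
  have hβ (d : Fin 3 → K) (e f : K) (a : Fin 3 → K) :
      β d (e, f, a) = (t ⬝ᵥ d) * e - (t ⬝ᵥ Q *ᵥ d) * f + d ⬝ᵥ M *ᵥ a := rfl
  refine hc.isSymplectic_of_injective ⟨4, by simp⟩ (β := β)
    ((injective_iff_map_eq_zero _).2 fun d hd => ?_) ?_
  · have hd' (u : K × K × (Fin 3 → K)) : β d u = 0 := LinearMap.congr_fun hd u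
    refine hinj d (by simpa [hβ] using hd' (1, 0, 0)) (by simpa [hβ] using hd' (0, 1, 0)) ?_
    refine dotProduct_eq_zero _ fun a => ?_
    rw [← dotProduct_mulVec]
    simpa [hβ] using hd' (0, 0, a)
  · have hM' (a b : Fin 3 → K) : a ⬝ᵥ M *ᵥ b - b ⬝ᵥ M *ᵥ a = -(t ⬝ᵥ P *ᵥ (a ⨯₃ b)) := by
      rw [dotProduct_mulVec_sub_dotProduct_mulVec, hM, neg_dotProduct, dotProduct_mulVec]
    have hQM' (a b : Fin 3 → K) :
        Q *ᵥ a ⬝ᵥ M *ᵥ b - Q *ᵥ b ⬝ᵥ M *ᵥ a = -(t ⬝ᵥ Q *ᵥ P *ᵥ (a ⨯₃ b)) := by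
      have h := dotProduct_mulVec_sub_dotProduct_mulVec (Qᵀ * M) a b
      rw [hQM, neg_dotProduct, ← dotProduct_mulVec] at h
      simpa only [← mulVec_mulVec, dotProduct_mulVec _ Qᵀ, vecMul_transpose] using h
    have hP (a b c : Fin 3 → K) : P *ᵥ (a ⨯₃ b) ⬝ᵥ M *ᵥ c + P *ᵥ (b ⨯₃ c) ⬝ᵥ M *ᵥ a
        + P *ᵥ (c ⨯₃ a) ⬝ᵥ M *ᵥ b = 0 := by
      have h := cyclic_sum_cross_dotProduct_mulVec (Pᵀ * M) a b c
      simpa only [← mulVec_mulVec, dotProduct_mulVec _ Pᵀ, vecMul_transpose, htrace, zero_mul]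
        using h
    rintro ⟨e₁, f₁, a₁⟩ ⟨e₂, f₂, a₂⟩ ⟨e₃, f₃, a₃⟩
    simp only [hβ, derivedThreeCocycle, dotProduct_add, dotProduct_sub, dotProduct_smul,
      add_dotProduct, sub_dotProduct, smul_dotProduct, mulVec_add, mulVec_sub, mulVec_smul,
      smul_eq_mul]
    linear_combination e₁ * hM' a₂ a₃ + e₂ * hM' a₃ a₁ + e₃ * hM' a₁ a₂ - f₁ * hQM' a₂ a₃
      - f₂ * hQM' a₃ a₁ - f₃ * hQM' a₁ a₂ + hP a₁ a₂ a₃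

theorem isSymplectic_of_isSymm (hc : IsCentralExtensionBy K L (derivedThreeCocycle P Q))
    {M : Matrix (Fin 3) (Fin 3) K} (hM : M.IsSymm) (hQM : (Qᵀ * M).IsSymm)
    (htrace : (Pᵀ * M).trace = 0) (hdet : M.det ≠ 0) : LieAlgebra.IsSymplectic K L := by
  refine hc.isSymplectic_of_axialVector_eq (t := 0) ?_ ?_ htrace fun d _ _ hd =>
    eq_zero_of_vecMul_eq_zero hdet hd
  · rw [axialVector_eq_zero hM, zero_vecMul, neg_zero]
  · rw [axialVector_eq_zero hQM, zero_vecMul, neg_zero]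

/-- The closed form pairs `(d, r)` with `(e, a)` to `r * e + d ⬝ᵥ M *ᵥ a + r * (m ⬝ᵥ a)`. -/
theorem isSymplectic_of_axialVector_eq_neg {p m : Fin 3 → K}
    (hc : IsCentralExtensionBy K L (derivedFourCocycle P p)) {M : Matrix (Fin 3) (Fin 3) K}
    (hM : axialVector M = -p) (hm : (Pᵀ * M + vecMulVec p m).trace = 0) (hdet : M.det ≠ 0) :
    LieAlgebra.IsSymplectic K L := by
  let β : (Fin 3 → K) × K →ₗ[K] Dual K (K × (Fin 3 → K)) := LinearMap.mk₂ K
    (fun d u => d.2 * u.1 + d.1 ⬝ᵥ M *ᵥ u.2 + d.2 * (m ⬝ᵥ u.2))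
    (fun d d' u => by simp only [add_dotProduct, Prod.fst_add, Prod.snd_add]; ring)
    (fun r d u => by simp only [smul_dotProduct, Prod.smul_fst, Prod.smul_snd, smul_eq_mul]; ring)
    (fun d u v => by simp only [dotProduct_add, mulVec_add, Prod.fst_add, Prod.snd_add]; ring)
    (fun r d u => by
      simp only [dotProduct_smul, mulVec_smul, Prod.smul_fst, Prod.smul_snd, smul_eq_mul]; ring)
  have hβ (d : Fin 3 → K) (r e : K) (a : Fin 3 → K) :
      β (d, r) (e, a) = r * e + d ⬝ᵥ M *ᵥ a + r * (m ⬝ᵥ a) := rfl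
  refine hc.isSymplectic_of_injective ⟨4, by simp⟩ (β := β)
    ((injective_iff_map_eq_zero _).2 fun ⟨d, r⟩ hd => ?_) ?_
  · have hd' (u : K × (Fin 3 → K)) : β (d, r) u = 0 := LinearMap.congr_fun hd u
    have hr : r = 0 := by simpa [hβ] using hd' (1, 0)
    have hdM : d ᵥ* M = 0 := dotProduct_eq_zero _ fun a => by
      rw [← dotProduct_mulVec]
      simpa [hβ, hr] using hd' (0, a)
    rw [eq_zero_of_vecMul_eq_zero hdet hdM, hr, Prod.mk_zero_zero]
  · have hM' (a b : Fin 3 → K) : a ⬝ᵥ M *ᵥ b - b ⬝ᵥ M *ᵥ a = -(p ⬝ᵥ a ⨯₃ b) := by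
      rw [dotProduct_mulVec_sub_dotProduct_mulVec, hM, neg_dotProduct]
    have hPm (a b c : Fin 3 → K) :
        P *ᵥ (a ⨯₃ b) ⬝ᵥ M *ᵥ c + P *ᵥ (b ⨯₃ c) ⬝ᵥ M *ᵥ a + P *ᵥ (c ⨯₃ a) ⬝ᵥ M *ᵥ b
          + ((p ⬝ᵥ a ⨯₃ b) * (m ⬝ᵥ c) + (p ⬝ᵥ b ⨯₃ c) * (m ⬝ᵥ a) + (p ⬝ᵥ c ⨯₃ a) * (m ⬝ᵥ b))
          = 0 := by
      have h := cyclic_sum_cross_dotProduct_mulVec (Pᵀ * M + vecMulVec p m) a b c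
      simp only [hm, zero_mul, add_mulVec, dotProduct_add, ← mulVec_mulVec, vecMulVec_mulVec,
        dotProduct_mulVec _ Pᵀ, vecMul_transpose, dotProduct_smul, MulOpposite.smul_eq_mul_unop,
        MulOpposite.unop_op, dotProduct_comm _ p] at h
      linear_combination h
    rintro ⟨e₁, a₁⟩ ⟨e₂, a₂⟩ ⟨e₃, a₃⟩
    simp only [hβ, derivedFourCocycle, add_dotProduct, sub_dotProduct, smul_dotProduct, smul_eq_mul]
    linear_combination e₁ * hM' a₂ a₃ + e₂ * hM' a₃ a₁ + e₃ * hM' a₁ a₂ + hPm a₁ a₂ a₃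

/-- The matrix `M` is unipotent with antisymmetric part given by `-p`, and `m` compensates the trace
of `Pᵀ * M`. -/
theorem isSymplectic_of_ne_zero {p : Fin 3 → K}
    (hc : IsCentralExtensionBy K L (derivedFourCocycle P p)) (hp : p ≠ 0) :
    LieAlgebra.IsSymplectic K L := by
  let M : Matrix (Fin 3) (Fin 3) K := !![1, -p 2, p 1; 0, 1, -p 0; 0, 0, 1]
  have hM : axialVector M = -p := by
    ext i
    fin_cases i <;> simp [axialVector, M]
  obtain ⟨i, hi : p i ≠ 0⟩ := Function.ne_iff.1 hp
  refine hc.isSymplectic_of_axialVector_eq_neg (m := Pi.single i (-(Pᵀ * M).trace / p i)) hM ?_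
    (by simp [M, det_fin_three])
  rw [trace_add, trace_vecMulVec, dotProduct_single, mul_div_cancel₀ _ hi, add_neg_cancel]

end IsCentralExtensionBy

end Cocycles

section NormalForms

variable {K : Type*} [Field K]

/-- The shapes to which a `3 × 3` matrix can be brought by conjugation and subtraction of a scalar:
a companion matrix if there is a cyclic vector, and a matrix of rank at most one otherwise. -/
inductive IsShiftedNormalForm : Matrix (Fin 3) (Fin 3) K → Prop
  | companion (a b c : K) : IsShiftedNormalForm !![0, 0, a; 1, 0, b; 0, 1, c]
  | diagonal (l : K) : IsShiftedNormalForm !![l, 0, 0; 0, 0, 0; 0, 0, 0]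
  | nilpotent : IsShiftedNormalForm !![0, 1, 0; 0, 0, 0; 0, 0, 0]

theorem exists_affine_eq_zero_and_mul_sub_sq_ne_zero {c p q r : K}
    (h : c = 0 ∨ p ≠ 0 ∨ q ≠ 0 ∨ r ≠ 0) :
    ∃ x y z : K, c + p * x + q * y + r * z = 0 ∧ x * z - y ^ 2 ≠ 0 := by
  by_cases hp : p ≠ 0
  · exact ⟨-(c + q) / p, 1, 0, by field_simp; ring, by simp⟩
  by_cases hr : r ≠ 0
  · exact ⟨0, 1, -(c + q) / r, by field_simp; ring, by simp⟩
  by_cases hq : q ≠ 0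
  · refine ⟨1, -c / q, (-c / q) ^ 2 + 1, ?_, by ring_nf; exact one_ne_zero⟩
    rw [not_not.1 hp, not_not.1 hr]
    field_simp
    ring
  · simp only [hp, hq, hr, or_false] at h
    exact ⟨1, 0, 1, by simp_all, by simp⟩

namespace IsCentralExtensionBy

variable {L : Type*} [LieRing L] [LieAlgebra K L] {P : Matrix (Fin 3) (Fin 3) K}

theorem isSymplectic_of_companion {a b c : K}
    (hc : IsCentralExtensionBy K L (derivedThreeCocycle P !![0, 0, a; 1, 0, b; 0, 1, c])) :
    LieAlgebra.IsSymplectic K L := by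
  let S : Matrix (Fin 3) (Fin 3) K := !![0, 0, 1; 0, 1, c; 1, c, b + c ^ 2]
  by_cases hS : (Pᵀ * S).trace = 0
  · refine hc.isSymplectic_of_isSymm (M := S) ?_ ?_ hS (by simp [S, det_fin_three])
    · ext i j
      fin_cases i <;> fin_cases j <;> simp [S]
    · ext i j
      fin_cases i <;> fin_cases j <;> simp [S, mul_apply, Fin.sum_univ_three] <;> ring
  · let M₀ : Matrix (Fin 3) (Fin 3) K :=
      !![1, 0, 0;
        P 2 2, -P 1 2 - P 2 1 - c * P 2 2, P 1 1 + a + b * P 2 2;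
        -P 2 1, P 1 1 + P 2 0 + a + b * P 2 2, -P 1 0 - b * (P 1 2 + P 2 1) + c * (P 1 1 + a)]
    let r := -(Pᵀ * M₀).trace / (Pᵀ * S).trace
    refine hc.isSymplectic_of_axialVector_eq (t := ![0, 0, 1]) (M := M₀ + r • S) ?_ ?_ ?_
      fun d h2 h1 h0 => ?_
    · ext i
      fin_cases i <;> simp [axialVector, vecMul, dotProduct, Fin.sum_univ_three, M₀, S]
    · ext i
      fin_cases i <;>
        simp [axialVector, vecMul, dotProduct, mul_apply, Fin.sum_univ_three, M₀, S] <;> ring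
    · rw [mul_add, Matrix.mul_smul, trace_add, trace_smul, smul_eq_mul, div_mul_cancel₀ _ hS,
        add_neg_cancel]
    · have hd2 : d 2 = 0 := by simpa [dotProduct, Fin.sum_univ_three] using h2
      have hd1 : d 1 = 0 := by simpa [dotProduct, mulVec, Fin.sum_univ_three, hd2] using h1
      have hd0 : d 0 = 0 := by
        simpa [vecMul, dotProduct, Fin.sum_univ_three, hd1, hd2, M₀, S] using congrFun h0 0
      ext i
      fin_cases i
      exacts [hd0, hd1, hd2]

theorem isSymplectic_of_nilpotent_of_add_eq_zero {x : K}
    (hc : IsCentralExtensionBy K L (derivedThreeCocycle P !![0, 1, 0; 0, 0, 0; 0, 0, 0]))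
    (hx : P 0 1 + P 1 0 + P 1 1 * x + P 2 2 = 0) : LieAlgebra.IsSymplectic K L := by
  refine hc.isSymplectic_of_isSymm (M := !![0, 1, 0; 1, x, 0; 0, 0, 1]) ?_ ?_ ?_
    (by simp [det_fin_three])
  · ext i j
    fin_cases i <;> fin_cases j <;> simp
  · ext i j
    fin_cases i <;> fin_cases j <;> simp [mul_apply, Fin.sum_univ_three]
  · simp only [trace, diag_apply, mul_apply, transpose_apply, of_apply, cons_val',
      cons_val_fin_one, Fin.sum_univ_three, Fin.isValue, cons_val_zero, cons_val_one, cons_val]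
    linear_combination hx

theorem isSymplectic_of_nilpotent_of_apply_one_one_eq_zero {u v : K}
    (hc : IsCentralExtensionBy K L (derivedThreeCocycle P !![0, 1, 0; 0, 0, 0; 0, 0, 0]))
    (h11 : P 1 1 = 0) (huv : P 1 2 + P 2 1 + (P 0 1 + P 1 0) * (u - P 2 0) + P 2 2 * v = 0) :
    LieAlgebra.IsSymplectic K L := by
  refine hc.isSymplectic_of_axialVector_eq (t := ![1, 0, 0])
    (M := !![P 1 2, u, -P 1 0; u + P 0 2, 0, 1 - P 0 0; -P 0 1 - P 1 0, 1, v]) ?_ ?_ ?_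
    fun d h0 h1 h2 => ?_
  · ext i
    fin_cases i <;> simp [axialVector, vecMul, dotProduct, Fin.sum_univ_three]
  · ext i
    fin_cases i <;> simp [axialVector, vecMul, dotProduct, mul_apply, Fin.sum_univ_three, h11]
  · simp only [trace, diag_apply, mul_apply, transpose_apply, of_apply, cons_val',
      cons_val_fin_one, Fin.sum_univ_three, Fin.isValue, cons_val_zero, cons_val_one, cons_val]
    linear_combination huv
  · have hd0 : d 0 = 0 := by simpa [dotProduct, Fin.sum_univ_three] using h0
    have hd1 : d 1 = 0 := by simpa [dotProduct, mulVec, Fin.sum_univ_three] using h1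
    have hd2 : d 2 = 0 := by
      simpa [vecMul, dotProduct, Fin.sum_univ_three, hd0, hd1] using congrFun h2 1
    ext i
    fin_cases i
    exacts [hd0, hd1, hd2]

theorem isSymplectic_of_nilpotent
    (hc : IsCentralExtensionBy K L (derivedThreeCocycle P !![0, 1, 0; 0, 0, 0; 0, 0, 0])) :
    LieAlgebra.IsSymplectic K L := by
  by_cases h11 : P 1 1 = 0
  · by_cases h22 : P 2 2 = 0
    · by_cases h01 : P 0 1 + P 1 0 = 0
      · exact hc.isSymplectic_of_nilpotent_of_add_eq_zero (x := 0) (by simp [h01, h22])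
      · exact hc.isSymplectic_of_nilpotent_of_apply_one_one_eq_zero h11
          (u := P 2 0 - (P 1 2 + P 2 1) / (P 0 1 + P 1 0)) (v := 0) (by field_simp; ring)
    · exact hc.isSymplectic_of_nilpotent_of_apply_one_one_eq_zero h11 (u := P 2 0)
        (v := -(P 1 2 + P 2 1) / P 2 2) (by field_simp; ring)
  · exact hc.isSymplectic_of_nilpotent_of_add_eq_zero
      (x := -(P 0 1 + P 1 0 + P 2 2) / P 1 1) (by field_simp; ring)

theorem isSymplectic_of_diagonal {l : K}
    (hc : IsCentralExtensionBy K L (derivedThreeCocycle P !![l, 0, 0; 0, 0, 0; 0, 0, 0]))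
    (hP : l = 0 ∨ P 0 0 = 0 ∨ P 1 1 ≠ 0 ∨ P 1 2 + P 2 1 ≠ 0 ∨ P 2 2 ≠ 0) :
    LieAlgebra.IsSymplectic K L := by
  by_cases hP' : P 0 0 = 0 ∨ P 1 1 ≠ 0 ∨ P 1 2 + P 2 1 ≠ 0 ∨ P 2 2 ≠ 0
  · obtain ⟨x, y, z, htrace, hdet⟩ := exists_affine_eq_zero_and_mul_sub_sq_ne_zero hP'
    refine hc.isSymplectic_of_isSymm (M := !![1, 0, 0; 0, x, y; 0, y, z]) ?_ ?_ ?_ ?_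
    · ext i j
      fin_cases i <;> fin_cases j <;> simp
    · ext i j
      fin_cases i <;> fin_cases j <;> simp [mul_apply, Fin.sum_univ_three]
    · simp only [trace, diag_apply, mul_apply, transpose_apply, of_apply, cons_val',
        cons_val_fin_one, Fin.sum_univ_three, Fin.isValue, cons_val_zero, cons_val_one, cons_val]
      linear_combination htrace
    · simpa [det_fin_three, sq] using hdet
  · obtain rfl : l = 0 := hP.resolve_right hP'
    obtain ⟨h00, -, -, h22⟩ : P 0 0 ≠ 0 ∧ P 1 1 = 0 ∧ P 1 2 + P 2 1 = 0 ∧ P 2 2 = 0 := by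
      simpa using hP'
    refine hc.isSymplectic_of_isSymm (M := !![-(P 0 1 + P 1 0) / P 0 0, 1, 0; 1, 0, 0; 0, 0, 1])
      ?_ ?_ ?_ (by simp [det_fin_three])
    · ext i j
      fin_cases i <;> fin_cases j <;> simp
    · ext i j
      fin_cases i <;> fin_cases j <;> simp [mul_apply, Fin.sum_univ_three]
    · simp only [trace, Fin.isValue, neg_add_rev, diag_apply, mul_apply, transpose_apply, of_apply,
        cons_val', cons_val_fin_one, Fin.sum_univ_three, cons_val_zero, cons_val_one, cons_val,
        mul_one, mul_zero, add_zero, h22]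
      field_simp
      ring

end IsCentralExtensionBy

end NormalForms

section ExceptionalCase

variable {K : Type*} [Field K]

/-- Coordinates identifying the extension with cocycle `derivedThreeCocycle P Q`, where `Q` is
diagonal with entries `l, 0, 0`, with the exceptional algebra when the criterion
`isSymplectic_of_diagonal` fails. The terms in `P` absorb all structure constants except `P 0 0`. -/
def exceptionalCoordinates (P : Matrix (Fin 3) (Fin 3) K) (l : K) :
    (K × K × (Fin 3 → K)) × (Fin 3 → K) →ₗ[K] ExceptionalAlgebra K :=
  show _ →ₗ[K] (Fin 8 → K) from
  { toFun := fun ((e, f, a), d) =>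
      ![e + P 1 2 * a 0 + P 2 0 * a 1 - P 1 0 * a 2, a 1, d 1, a 2, d 2, a 0 / P 0 0, d 0 / P 0 0,
        l * f + (P 0 2 + P 2 0) * a 1 - (P 0 1 + P 1 0) * a 2]
    map_add' := fun x y => by ext i; fin_cases i <;> simp <;> ring
    map_smul' := fun r x => by ext i; fin_cases i <;> simp <;> ring }

namespace exceptionalCoordinates

variable {P : Matrix (Fin 3) (Fin 3) K} {l : K}

theorem apply_apply (e f : K) (a d : Fin 3 → K) (i : Fin 8) :
    exceptionalCoordinates P l ((e, f, a), d) i =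
      (![e + P 1 2 * a 0 + P 2 0 * a 1 - P 1 0 * a 2, a 1, d 1, a 2, d 2, a 0 / P 0 0, d 0 / P 0 0,
        l * f + (P 0 2 + P 2 0) * a 1 - (P 0 1 + P 1 0) * a 2] : Fin 8 → K) i :=
  rfl

theorem bijective (hl : l ≠ 0) (h00 : P 0 0 ≠ 0) :
    Function.Bijective (exceptionalCoordinates P l) := by
  have hinj : Function.Injective (exceptionalCoordinates P l) := by
    refine (injective_iff_map_eq_zero _).2 fun ⟨⟨e, f, a⟩, d⟩ h => ?_
    have h' (i : Fin 8) := (apply_apply e f a d i).symm.trans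
      ((congrFun h i).trans (ExceptionalAlgebra.zero_apply i))
    have ha : a = 0 := by
      ext i
      fin_cases i
      exacts [by simpa [h00] using h' 5, h' 1, h' 3]
    have hd : d = 0 := by
      ext i
      fin_cases i
      exacts [by simpa [h00] using h' 6, h' 2, h' 4]
    have he : e = 0 := by simpa [ha] using h' 0
    have hf : f = 0 := by simpa [ha, hl] using h' 7
    rw [ha, hd, he, hf]
    rfl
  have hdim : finrank K ((K × K × (Fin 3 → K)) × (Fin 3 → K)) =
      finrank K (ExceptionalAlgebra K) := by
    change _ = finrank K (Fin 8 → K)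
    simp
  have : FiniteDimensional K (ExceptionalAlgebra K) :=
    inferInstanceAs (FiniteDimensional K (Fin 8 → K))
  exact ⟨hinj, (LinearMap.injective_iff_surjective_of_finrank_eq_finrank hdim).1 hinj⟩

theorem lie_eq (h00 : P 0 0 ≠ 0) (h11 : P 1 1 = 0) (h12 : P 1 2 + P 2 1 = 0) (h22 : P 2 2 = 0)
    (x y : (K × K × (Fin 3 → K)) × (Fin 3 → K)) :
    ⁅exceptionalCoordinates P l x, exceptionalCoordinates P l y⁆ = exceptionalCoordinates P l
      (0, derivedThreeCocycle P !![l, 0, 0; 0, 0, 0; 0, 0, 0] x.1 y.1) := by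
  obtain ⟨⟨e, f, a⟩, d⟩ := x
  obtain ⟨⟨e', f', a'⟩, d'⟩ := y
  have h21 : P 2 1 = -P 1 2 := eq_neg_of_add_eq_zero_right h12
  funext i
  rw [ExceptionalAlgebra.bracket_apply, ← Prod.mk_zero_zero, ← Prod.mk_zero_zero]
  fin_cases i <;>
    simp [apply_apply, derivedThreeCocycle, cross_apply, mulVec, dotProduct, Fin.sum_univ_three,
      vecHead, vecTail, h11, h21, h22]
  · ring
  · ring
  · field_simp
    ring

end exceptionalCoordinates

theorem IsCentralExtensionBy.nonempty_lieEquiv_exceptionalAlgebra {L : Type*} [LieRing L]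
    [LieAlgebra K L] {P : Matrix (Fin 3) (Fin 3) K} {l : K}
    (hc : IsCentralExtensionBy K L (derivedThreeCocycle P !![l, 0, 0; 0, 0, 0; 0, 0, 0]))
    (hl : l ≠ 0) (h00 : P 0 0 ≠ 0) (h11 : P 1 1 = 0) (h12 : P 1 2 + P 2 1 = 0) (h22 : P 2 2 = 0) :
    Nonempty (L ≃ₗ⁅K⁆ ExceptionalAlgebra K) := by
  obtain ⟨Φ, hΦ⟩ := hc
  let Ψ : L ≃ₗ[K] ExceptionalAlgebra K :=
    Φ.trans (LinearEquiv.ofBijective _ (exceptionalCoordinates.bijective hl h00))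
  refine ⟨{ Ψ with map_lie' := fun {x y} => ?_ }⟩
  change exceptionalCoordinates P l (Φ ⁅x, y⁆) =
    ⁅exceptionalCoordinates P l (Φ x), exceptionalCoordinates P l (Φ y)⁆
  rw [hΦ, exceptionalCoordinates.lie_eq h00 h11 h12 h22]

theorem IsCentralExtensionBy.isSymplectic_or_nonempty_lieEquiv {L : Type*} [LieRing L]
    [LieAlgebra K L] {P Q : Matrix (Fin 3) (Fin 3) K} (hQ : IsShiftedNormalForm Q)
    (hc : IsCentralExtensionBy K L (derivedThreeCocycle P Q)) :
    LieAlgebra.IsSymplectic K L ∨ Nonempty (L ≃ₗ⁅K⁆ ExceptionalAlgebra K) := by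
  cases hQ with
  | companion => exact Or.inl hc.isSymplectic_of_companion
  | nilpotent => exact Or.inl hc.isSymplectic_of_nilpotent
  | diagonal l =>
    by_cases h : l = 0 ∨ P 0 0 = 0 ∨ P 1 1 ≠ 0 ∨ P 1 2 + P 2 1 ≠ 0 ∨ P 2 2 ≠ 0
    · exact Or.inl (hc.isSymplectic_of_diagonal h)
    · push Not at h
      obtain ⟨hl, h00, h11, h12, h22⟩ := h
      exact Or.inr (hc.nonempty_lieEquiv_exceptionalAlgebra hl h00 h11 h12 h22)

end ExceptionalCase

section Endomorphisms

theorem linearIndependent_triple_iff {R V : Type*} [Ring R] [AddCommGroup V] [Module R V]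
    {u v w : V} : LinearIndependent R ![u, v, w] ↔
      ∀ a b c : R, a • u + b • v + c • w = 0 → a = 0 ∧ b = 0 ∧ c = 0 := by
  simp [Fintype.linearIndependent_iff, Fin.sum_univ_three, Fin.forall_fin_succ_pi,
    Fin.forall_fin_succ]

variable {K E : Type*} [Field K] [AddCommGroup E] [Module K E]

theorem linearIndependent_iterate_add_smul_one {N : End K E} {y : E}
    (h : LinearIndependent K ![y, N y, N (N y)]) (r : K) :
    LinearIndependent K ![y, (N + r • 1) y, (N + r • 1) ((N + r • 1) y)] := by
  rw [linearIndependent_triple_iff] at h ⊢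
  intro a b c habc
  simp only [LinearMap.add_apply, LinearMap.smul_apply, End.one_apply, map_add, map_smul] at habc
  obtain ⟨h0, h1, rfl⟩ := h (a + b * r + c * r ^ 2) (b + 2 * c * r) c (by rw [← habc]; module)
  obtain rfl : b = 0 := by simpa using h1
  exact ⟨by simpa using h0, rfl, rfl⟩

/-- If `N y = a • z + b • N z` with `a ≠ 0`, then `y - b • z` is a cyclic vector. -/
theorem range_le_span_singleton_of_range_le_span_pair {N : End K E}
    (hN : ∀ y, ¬ LinearIndependent K ![y, N y, N (N y)]) {z : E}
    (hz : LinearIndependent K ![z, N z]) (hrange : LinearMap.range N ≤ Submodule.span K {z, N z})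
    (htop : Submodule.span K {z, N z} ≠ ⊤) : LinearMap.range N ≤ Submodule.span K {N z} := by
  set W := Submodule.span K {z, N z}
  have hzW : z ∈ W := Submodule.subset_span (by simp)
  have hmem {y : E} (hy : y ∉ W) : N y ∈ Submodule.span K {N z} := by
    obtain ⟨a, b, hab⟩ := Submodule.mem_span_pair.1 (hrange ⟨y, rfl⟩)
    obtain rfl : a = 0 := by
      by_contra ha
      have hy' : y - b • z ∉ W := fun h => hy (by simpa using add_mem h (W.smul_mem b hzW))
      have hNy : N (y - b • z) = a • z := by
        rw [map_sub, map_smul, ← hab, add_sub_cancel_right]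
      have hind : LinearIndependent K ![y - b • z, z, N z] :=
        hz.finCons (by rwa [range_cons_cons_empty])
      refine hN (y - b • z) ?_
      rw [linearIndependent_triple_iff] at hind ⊢
      intro c d e h
      rw [hNy, map_smul, smul_smul, smul_smul] at h
      simpa [ha] using hind _ _ _ h
    exact Submodule.mem_span_singleton.2 ⟨b, by rw [← hab, zero_smul, zero_add]⟩
  obtain ⟨y, -, hy⟩ := SetLike.exists_of_lt htop.lt_top
  rintro _ ⟨t, rfl⟩
  by_cases ht : t ∈ W
  · simpa using sub_mem (hmem fun h => hy ((W.add_mem_iff_right ht).1 h)) (hmem hy)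
  · exact hmem ht

theorem exists_range_sub_smul_one_le [FiniteDimensional K E] {W : Submodule K E}
    (hW : finrank K E = finrank K W + 1) {Q : End K E} (hQW : W ≤ W.comap Q) :
    ∃ r : K, LinearMap.range (Q - r • 1) ≤ W := by
  obtain ⟨r, hr, -⟩ := LinearMap.existsUnique_eq_smul_id_of_finrank_eq_one
    (by have := W.finrank_quotient_add_finrank; omega) (W.mapQ W Q hQW)
  refine ⟨r, ?_⟩
  rintro _ ⟨y, rfl⟩
  simpa [Submodule.Quotient.eq, ← Submodule.Quotient.mk_smul] using
    LinearMap.congr_fun hr (W.mkQ y)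

theorem exists_range_sub_smul_one_le_span_singleton (hE : finrank K E = 3) {Q : End K E}
    (hQ : ∀ y, ¬ LinearIndependent K ![y, Q y, Q (Q y)]) :
    ∃ (r : K) (u : E), LinearMap.range (Q - r • 1) ≤ Submodule.span K {u} := by
  have : FiniteDimensional K E := FiniteDimensional.of_finrank_pos (by rw [hE]; norm_num)
  by_cases hscalar : ∀ z, ¬ LinearIndependent K ![z, Q z]
  · obtain ⟨r, rfl⟩ := LinearMap.exists_eq_smul_id_of_forall_notLinearIndependent hscalar
    exact ⟨r, 0, by simp⟩
  push Not at hscalar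
  obtain ⟨z, hz⟩ := hscalar
  set W := Submodule.span K (Set.range ![z, Q z]) with hW
  have hWdim : finrank K W = 2 := finrank_span_eq_card hz
  have hzW : z ∈ W := Submodule.subset_span ⟨0, rfl⟩
  have hQzW : Q z ∈ W := Submodule.subset_span ⟨1, rfl⟩
  have hQQz : Q (Q z) ∈ W := by
    by_contra h
    have hind := linearIndependent_triple_iff.1 (hz.finCons h)
    refine hQ z (linearIndependent_triple_iff.2 fun a b c habc => ?_)
    obtain ⟨hc, ha, hb⟩ := hind c a b (by rw [← habc]; abel)
    exact ⟨ha, hb, hc⟩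
  have hQW : W ≤ W.comap Q := by
    rw [hW, Submodule.span_le, ← hW]
    rintro _ ⟨i, rfl⟩
    fin_cases i
    exacts [hQzW, hQQz]
  obtain ⟨r, hr⟩ := exists_range_sub_smul_one_le (by rw [hE, hWdim]) hQW
  set N := Q - r • 1
  have hNz : N z = (-r) • z + (1 : K) • Q z := by simp [N, neg_add_eq_sub]
  have hzN : LinearIndependent K ![z, N z] := by
    simpa [hNz] using
      (LinearIndependent.pair_add_smul_add_smul_iff (1 : K) 0 (-r) 1).2 ⟨hz, by simp⟩
  have hspan : Submodule.span K (Set.range ![z, N z]) = W := by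
    refine Submodule.eq_of_le_of_finrank_eq (Submodule.span_le.2 ?_)
      ((finrank_span_eq_card hzN).trans hWdim.symm)
    rw [Set.range_subset_iff, Fin.forall_fin_two]
    exact ⟨hzW, hNz ▸ add_mem (W.smul_mem _ hzW) (W.smul_mem _ hQzW)⟩
  rw [range_cons_cons_empty] at hspan
  refine ⟨r, N z, range_le_span_singleton_of_range_le_span_pair (fun y hy => hQ y ?_) hzN
    (hspan ▸ hr) ?_⟩
  · simpa [N] using linearIndependent_iterate_add_smul_one hy r
  · rintro h
    rw [← hspan, h, finrank_top] at hWdim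
    omega

theorem exists_basis_eq_toLin (hE : finrank K E = 3) {N : End K E} {u v w : E}
    (h : LinearIndependent K ![u, v, w]) (M : Matrix (Fin 3) (Fin 3) K)
    (hu : N u = M 0 0 • u + M 1 0 • v + M 2 0 • w) (hv : N v = M 0 1 • u + M 1 1 • v + M 2 1 • w)
    (hw : N w = M 0 2 • u + M 1 2 • v + M 2 2 • w) :
    ∃ z : Basis (Fin 3) K E, N = toLin z z M := by
  refine ⟨basisOfLinearIndependentOfCardEqFinrank h (by simp [hE]), Basis.ext
    (basisOfLinearIndependentOfCardEqFinrank h (by simp [hE])) fun i => ?_⟩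
  rw [toLin_self, Fin.sum_univ_three]
  fin_cases i
  · simpa using hu
  · simpa using hv
  · simpa using hw

theorem exists_mem_linearIndependent_pair {W : Submodule K E} (hW : 1 < finrank K W) {k : E}
    (hk : k ∈ W) (hk0 : k ≠ 0) : ∃ k' ∈ W, LinearIndependent K ![k, k'] := by
  obtain ⟨k', hk'⟩ := exists_linearIndependent_pair_of_one_lt_finrank hW (x := ⟨k, hk⟩)
    (by simpa using hk0)
  refine ⟨k', k'.2, ?_⟩
  rw [LinearIndependent.pair_iff] at hk' ⊢
  exact fun a b hab => hk' a b (Subtype.ext hab)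

theorem exists_apply_apply_eq_smul_of_range_le_span_singleton {N : End K E} {u : E}
    (hN : LinearMap.range N ≤ Submodule.span K {u}) (x : E) : ∃ l : K, N (N x) = l • N x := by
  obtain ⟨c, hc⟩ := Submodule.mem_span_singleton.1 (hN ⟨x, rfl⟩)
  obtain ⟨d, hd⟩ := Submodule.mem_span_singleton.1 (hN ⟨u, rfl⟩)
  exact ⟨d, by rw [← hc, map_smul, ← hd, smul_comm]⟩

theorem exists_eq_toLin_nilpotent (hE : finrank K E = 3) {N : End K E}
    (hker : 1 < finrank K (LinearMap.ker N)) {x : E} (hx : N x ≠ 0) (hNx : N (N x) = 0) :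
    ∃ z : Basis (Fin 3) K E, N = toLin z z !![0, 1, 0; 0, 0, 0; 0, 0, 0] := by
  obtain ⟨k, hk : N k = 0, hind⟩ := exists_mem_linearIndependent_pair hker hNx hx
  have hind' : LinearIndependent K ![N x, x, k] := by
    refine linearIndependent_triple_iff.2 fun a b c habc => ?_
    obtain rfl : b = 0 := by simpa [hNx, hk, hx] using congrArg N habc
    obtain ⟨ha, hc⟩ := LinearIndependent.pair_iff.1 hind a c (by simpa using habc)
    exact ⟨ha, rfl, hc⟩
  exact exists_basis_eq_toLin hE hind' _ (by simp [hNx]) (by simp) (by simp [hk])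

theorem exists_eq_toLin_diagonal (hE : finrank K E = 3) {N : End K E}
    (hker : 1 < finrank K (LinearMap.ker N)) {x : E} (hx : N x ≠ 0) {l : K} (hl : l ≠ 0)
    (hNx : N (N x) = l • N x) :
    ∃ z : Basis (Fin 3) K E, N = toLin z z !![l, 0, 0; 0, 0, 0; 0, 0, 0] := by
  have hbot : LinearMap.ker N ≠ ⊥ := fun h => by
    rw [h, finrank_bot] at hker
    omega
  obtain ⟨k, hk : N k = 0, hk0⟩ := Submodule.exists_mem_ne_zero_of_ne_bot hbot
  obtain ⟨k', hk' : N k' = 0, hind⟩ := exists_mem_linearIndependent_pair hker hk hk0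
  have hind' : LinearIndependent K ![N x, k, k'] := by
    refine linearIndependent_triple_iff.2 fun a b c habc => ?_
    obtain rfl : a = 0 := by simpa [hNx, hl, hk, hk', hx] using congrArg N habc
    exact ⟨rfl, LinearIndependent.pair_iff.1 hind b c (by simpa using habc)⟩
  exact exists_basis_eq_toLin hE hind' _ (by simp [hNx]) (by simp [hk]) (by simp [hk'])

theorem exists_isShiftedNormalForm_of_range_le_span_singleton (hE : finrank K E = 3)
    {N : End K E} {u : E} (hN : LinearMap.range N ≤ Submodule.span K {u}) :
    ∃ (z : Basis (Fin 3) K E) (M : Matrix (Fin 3) (Fin 3) K),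
      IsShiftedNormalForm M ∧ N = toLin z z M := by
  have : FiniteDimensional K E := FiniteDimensional.of_finrank_pos (by rw [hE]; norm_num)
  by_cases hzero : N = 0
  · exact ⟨finBasisOfFinrankEq K E hE, _, .diagonal 0, by
      rw [hzero, eq_comm, LinearEquiv.map_eq_zero_iff]
      ext i j
      fin_cases i <;> fin_cases j <;> rfl⟩
  obtain ⟨x, hx : N x ≠ 0⟩ := DFunLike.ne_iff.1 hzero
  have hker : 1 < finrank K (LinearMap.ker N) := by
    have h := LinearMap.finrank_range_add_finrank_ker N
    have h' : finrank K (LinearMap.range N) ≤ 1 :=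
      (Submodule.finrank_mono hN).trans ((finrank_span_le_card {u}).trans_eq (by simp))
    omega
  obtain ⟨l, hl⟩ := exists_apply_apply_eq_smul_of_range_le_span_singleton hN x
  by_cases hl0 : l = 0
  · obtain ⟨z, hz⟩ := exists_eq_toLin_nilpotent hE hker hx (by rw [hl, hl0, zero_smul])
    exact ⟨z, _, .nilpotent, hz⟩
  · obtain ⟨z, hz⟩ := exists_eq_toLin_diagonal hE hker hx hl0 hl
    exact ⟨z, _, .diagonal l, hz⟩

theorem exists_isShiftedNormalForm_add_smul_one (hE : finrank K E = 3) (Q : End K E) :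
    ∃ (z : Basis (Fin 3) K E) (M : Matrix (Fin 3) (Fin 3) K) (r : K),
      IsShiftedNormalForm M ∧ Q = toLin z z M + r • 1 := by
  by_cases hQ : ∃ y, LinearIndependent K ![y, Q y, Q (Q y)]
  · obtain ⟨y, hy⟩ := hQ
    have : Q (Q (Q y)) ∈ Submodule.span K (Set.range ![y, Q y, Q (Q y)]) := by
      rw [hy.span_eq_top_of_card_eq_finrank (by simp [hE])]
      trivial
    obtain ⟨c, hc⟩ := Submodule.mem_span_range_iff_exists_fun K |>.1 this
    obtain ⟨z, hz⟩ := exists_basis_eq_toLin hE (N := Q) hy !![0, 0, c 0; 1, 0, c 1; 0, 1, c 2]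
      (by simp) (by simp) (by simp [← hc, Fin.sum_univ_three])
    exact ⟨z, _, 0, .companion _ _ _, by rw [← hz, zero_smul, add_zero]⟩
  · push Not at hQ
    obtain ⟨r, u, hu⟩ := exists_range_sub_smul_one_le_span_singleton hE hQ
    obtain ⟨z, M, hM, hz⟩ := exists_isShiftedNormalForm_of_range_le_span_singleton hE hu
    exact ⟨z, M, r, hM, by rw [← hz, sub_add_cancel]⟩

end Endomorphisms

section AdaptedFrames

variable {K L : Type*} [Field K] [LieRing L] [LieAlgebra K L]

/-- Generators `x`, `w`, `τ a` of a two-step nilpotent Lie algebra such that `w` commutes with `x`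
and `ad x` embeds the space of parameters of `τ` by `ι`. In the applications the dimensions force
`x`, `w`, `τ` and `ι` to span the Lie algebra. -/
structure IsAdaptedFrame {F : Type*} [AddCommGroup F] [Module K F] (x w : L) (τ ι : F →ₗ[K] L) :
    Prop where
  lie_lie_eq_zero (X Y Z : L) : ⁅X, ⁅Y, Z⁆⁆ = 0
  lie_apply (d : F) : ⁅x, τ d⁆ = ι d
  lie_eq_zero : ⁅x, w⁆ = 0
  injective : Function.Injective ι
  notMem : w ∉ Submodule.span K {x} ⊔ LinearMap.range ι

theorem notMem_range_ad_of_ad_ne_zero (hnil : ∀ X Y Z : L, ⁅X, ⁅Y, Z⁆⁆ = 0) {x : L}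
    (hx : LieAlgebra.ad K L x ≠ 0) : x ∉ LinearMap.range (LieAlgebra.ad K L x) := by
  rintro ⟨y, hy⟩
  refine hx (LinearMap.ext fun z => ?_)
  rw [LieAlgebra.ad_apply, ← lie_skew, ← hy, LieAlgebra.ad_apply, hnil, neg_zero,
    LinearMap.zero_apply]

theorem mem_of_mem_span_singleton_sup {x v : L} {S : Submodule K L}
    (hS : ∀ d ∈ S, ∀ X : L, ⁅X, d⁆ = 0) (hx : LieAlgebra.ad K L x ≠ 0) (hv : ∀ X : L, ⁅X, v⁆ = 0)
    (h : v ∈ Submodule.span K {x} ⊔ S) : v ∈ S := by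
  obtain ⟨y, hy, d, hd, rfl⟩ := Submodule.mem_sup.1 h
  obtain ⟨e, rfl⟩ := Submodule.mem_span_singleton.1 hy
  obtain rfl : e = 0 := by
    by_contra he
    refine hx (LinearMap.ext fun z => ?_)
    have := hv z
    rw [lie_add, hS d hd, add_zero, lie_smul, smul_eq_zero_iff_right he] at this
    rw [LieAlgebra.ad_apply, ← lie_skew, this, neg_zero, LinearMap.zero_apply]
  rwa [zero_smul, zero_add]

namespace IsAdaptedFrame

variable {F : Type*} [AddCommGroup F] [Module K F] {x w : L} {τ ι : F →ₗ[K] L}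

theorem lie_apply_right (h : IsAdaptedFrame x w τ ι) (X : L) (d : F) : ⁅X, ι d⁆ = 0 := by
  rw [← h.lie_apply, h.lie_lie_eq_zero]

theorem apply_lie (h : IsAdaptedFrame x w τ ι) (a : F) : ⁅τ a, x⁆ = -ι a := by
  rw [← lie_skew, h.lie_apply]

theorem ad_ne_zero [Nontrivial F] (h : IsAdaptedFrame x w τ ι) : LieAlgebra.ad K L x ≠ 0 := by
  obtain ⟨d, hd⟩ := exists_ne (0 : F)
  intro hx
  refine hd (h.injective ?_)
  rw [map_zero, ← h.lie_apply, ← LieAlgebra.ad_apply K, hx, LinearMap.zero_apply]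

theorem mem_range_of_mem_sup [Nontrivial F] (h : IsAdaptedFrame x w τ ι) {v : L}
    (hv : ∀ X : L, ⁅X, v⁆ = 0) (hmem : v ∈ Submodule.span K {x} ⊔ LinearMap.range ι) :
    v ∈ LinearMap.range ι :=
  mem_of_mem_span_singleton_sup (by rintro _ ⟨d, rfl⟩ X; exact h.lie_apply_right X d) h.ad_ne_zero
    hv hmem

theorem eq_zero_of_add_eq_zero [Nontrivial F] (h : IsAdaptedFrame x w τ ι) {e f : K} {a d : F}
    (hsum : e • x + f • w + τ a + ι d = 0) : e = 0 ∧ f = 0 ∧ a = 0 ∧ d = 0 := by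
  obtain rfl : a = 0 := by
    refine h.injective ?_
    simpa [h.lie_eq_zero, h.lie_apply, h.lie_apply_right] using congrArg (fun y => ⁅x, y⁆) hsum
  rw [map_zero, add_zero] at hsum
  obtain rfl : f = 0 := by
    by_contra hf
    refine h.notMem ((Submodule.smul_mem_iff _ hf).1 ?_)
    rw [show f • w = (-e) • x + ι (-d) by
      rw [map_neg, ← sub_eq_zero, ← hsum]; module]
    exact Submodule.add_mem_sup (Submodule.smul_mem _ _ (Submodule.mem_span_singleton_self x))
      ⟨_, rfl⟩
  rw [zero_smul, add_zero] at hsum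
  obtain rfl : e = 0 := by
    by_contra he
    have hx : x ∈ LinearMap.range ι := by
      refine (Submodule.smul_mem_iff _ he).1 ?_
      rw [eq_neg_of_add_eq_zero_left hsum, ← map_neg]
      exact ⟨_, rfl⟩
    obtain ⟨c, rfl⟩ := hx
    refine h.ad_ne_zero (LinearMap.ext fun y => ?_)
    rw [LieAlgebra.ad_apply, ← lie_skew, h.lie_apply_right, neg_zero, LinearMap.zero_apply]
  rw [zero_smul, zero_add] at hsum
  exact ⟨rfl, rfl, rfl, h.injective (by rw [hsum, map_zero])⟩

theorem exists_eq_add [Nontrivial F] [FiniteDimensional K F] [FiniteDimensional K L]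
    (h : IsAdaptedFrame x w τ ι) (hdim : finrank K L = 2 * finrank K F + 2) (X : L) :
    ∃ (e f : K) (a d : F), X = e • x + f • w + τ a + ι d := by
  let Ψ : K × K × F × F →ₗ[K] L := (LinearMap.toSpanSingleton K L x).coprod
    ((LinearMap.toSpanSingleton K L w).coprod (τ.coprod ι))
  have hΨ (e f : K) (a d : F) : Ψ (e, f, a, d) = e • x + f • w + τ a + ι d := by
    simp [Ψ, add_assoc]
  have hinj : Function.Injective Ψ :=
    (injective_iff_map_eq_zero _).2 fun ⟨e, f, a, d⟩ hsum => by
      simpa using h.eq_zero_of_add_eq_zero ((hΨ e f a d).symm.trans hsum)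
  have hfinrank : finrank K (K × K × F × F) = finrank K L := by
    simp only [finrank_prod, finrank_self]
    omega
  obtain ⟨⟨e, f, a, d⟩, rfl⟩ :=
    (LinearMap.injective_iff_surjective_of_finrank_eq_finrank hfinrank).1 hinj X
  exact ⟨e, f, a, d, hΨ e f a d⟩

end IsAdaptedFrame

theorem exists_lie_eq_apply_cross {G : Type*} [AddCommGroup G] [Module K G]
    (τ : (Fin 3 → K) →ₗ[K] L) {κ : G →ₗ[K] L}
    (hκ : ∀ a b, ⁅τ a, τ b⁆ ∈ LinearMap.range κ) :
    ∃ P : (Fin 3 → K) →ₗ[K] G, ∀ a b, ⁅τ a, τ b⁆ = κ (P (a ⨯₃ b)) :=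
  exists_eq_comp_cross (B := (LieAlgebra.ad K L : L →ₗ[K] L →ₗ[K] L).compl₁₂ τ τ)
    (fun _ => lie_self _) hκ

namespace IsAdaptedFrame

variable [FiniteDimensional K L] {x w : L} {τ ι : (Fin 3 → K) →ₗ[K] L}

theorem exists_isCentralExtensionBy_derivedThreeCocycle (h : IsAdaptedFrame x w τ ι)
    (hdim : finrank K L = 8) (hι : ∀ X Y : L, ⁅X, Y⁆ ∈ LinearMap.range ι)
    {Q : Matrix (Fin 3) (Fin 3) K} (hQ : ∀ a, ⁅τ a, w⁆ = ι (Q *ᵥ a)) :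
    ∃ P, IsCentralExtensionBy K L (derivedThreeCocycle P Q) := by
  obtain ⟨P, hP⟩ := exists_lie_eq_apply_cross τ fun a b => hι (τ a) (τ b)
  have hwτ (a : Fin 3 → K) : ⁅w, τ a⁆ = -ι (Q *ᵥ a) := by rw [← lie_skew, hQ]
  have hwx : ⁅w, x⁆ = 0 := by rw [← lie_skew, h.lie_eq_zero, neg_zero]
  refine ⟨LinearMap.toMatrix' P, .of_lie_eq ((LinearMap.toSpanSingleton K L x).coprod
    ((LinearMap.toSpanSingleton K L w).coprod τ)) ι h.lie_apply_right ?_ ?_ (by simp [hdim])⟩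
  · rintro ⟨e, f, a⟩ ⟨e', f', a'⟩
    simp only [derivedThreeCocycle, LinearMap.coprod_apply, LinearMap.toSpanSingleton_apply,
      lie_add, add_lie, lie_smul, smul_lie, lie_self, h.lie_apply, h.lie_eq_zero, h.apply_lie, hwτ,
      hwx, hQ, hP, LinearMap.toMatrix'_mulVec, map_add, map_sub, map_smul]
    module
  · rintro ⟨e, f, a⟩ d hsum
    simpa [and_assoc] using h.eq_zero_of_add_eq_zero (e := e) (f := f) (a := a) (d := d)
      (by simpa [add_assoc] using hsum)

theorem mem_range_of_central (h : IsAdaptedFrame x w τ ι) (hdim : finrank K L = 8)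
    (hw : ∀ X : L, ⁅X, w⁆ = 0) {v : L} (hv : ∀ X : L, ⁅X, v⁆ = 0) :
    v ∈ LinearMap.range (ι.coprod (LinearMap.toSpanSingleton K L w)) := by
  obtain ⟨e, f, a, d, rfl⟩ := h.exists_eq_add (by simp [hdim]) v
  obtain rfl : a = 0 := by
    refine h.injective ?_
    simpa [hw, h.lie_apply, h.lie_apply_right] using hv x
  have hx : e • x ∈ LinearMap.range ι := by
    refine h.mem_range_of_mem_sup (fun X => ?_) (Submodule.mem_sup_left
      (Submodule.smul_mem _ _ (Submodule.mem_span_singleton_self x)))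
    simpa [hw, h.lie_apply_right] using hv X
  obtain ⟨d', hd'⟩ := hx
  refine ⟨(d' + d, f), ?_⟩
  simp only [LinearMap.coprod_apply, LinearMap.toSpanSingleton_apply, map_add, hd', map_zero]
  abel

theorem exists_isCentralExtensionBy_derivedFourCocycle (h : IsAdaptedFrame x w τ ι)
    (hdim : finrank K L = 8) (hw : ∀ X : L, ⁅X, w⁆ = 0) {b c : Fin 3 → K}
    (hbc : ⁅τ b, τ c⁆ ∉ LinearMap.range ι) :
    ∃ (P : Matrix (Fin 3) (Fin 3) K) (p : Fin 3 → K),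
      p ≠ 0 ∧ IsCentralExtensionBy K L (derivedFourCocycle P p) := by
  let κ : (Fin 3 → K) × K →ₗ[K] L := ι.coprod (LinearMap.toSpanSingleton K L w)
  have hκ (d : Fin 3 → K) (g : K) : κ (d, g) = ι d + g • w := by simp [κ]
  have hκ_central (X : L) (d : (Fin 3 → K) × K) : ⁅X, κ d⁆ = 0 := by
    rw [hκ, lie_add, lie_smul, hw, h.lie_apply_right, smul_zero, add_zero]
  obtain ⟨P, hP⟩ := exists_lie_eq_apply_cross τ (κ := κ) fun a b =>
    h.mem_range_of_central hdim hw fun X => h.lie_lie_eq_zero X (τ a) (τ b)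
  let p : Fin 3 → K := (dotProductEquiv K (Fin 3)).symm (LinearMap.snd K _ _ ∘ₗ P)
  have hp (a : Fin 3 → K) : p ⬝ᵥ a = (P a).2 :=
    LinearMap.congr_fun ((dotProductEquiv K (Fin 3)).apply_symm_apply (LinearMap.snd K _ _ ∘ₗ P)) a
  refine ⟨LinearMap.toMatrix' (LinearMap.fst K _ _ ∘ₗ P), p, fun hp0 => hbc ?_, .of_lie_eq
    ((LinearMap.toSpanSingleton K L x).coprod τ) κ hκ_central ?_ ?_ (by simp [hdim])⟩
  · have hP0 : (P (b ⨯₃ c)).2 = 0 := by rw [← hp, hp0, zero_dotProduct]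
    refine ⟨(P (b ⨯₃ c)).1, ?_⟩
    rw [hP, ← Prod.mk.eta (p := P (b ⨯₃ c)), hκ, hP0, zero_smul, add_zero]
  · rintro ⟨e, a⟩ ⟨e', a'⟩
    simp only [derivedFourCocycle, LinearMap.coprod_apply, LinearMap.toSpanSingleton_apply,
      lie_add, add_lie, lie_smul, smul_lie, lie_self, h.lie_apply, h.apply_lie, hP, hp, hκ,
      LinearMap.toMatrix'_mulVec, LinearMap.comp_apply, LinearMap.fst_apply, map_add, map_sub,
      map_smul]
    module
  · rintro ⟨e, a⟩ ⟨d, g⟩ hsum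
    obtain ⟨he, hg, ha, hd⟩ := h.eq_zero_of_add_eq_zero (e := e) (f := g) (a := a) (d := d) (by
      rw [← hsum, hκ]
      simp only [LinearMap.coprod_apply, LinearMap.toSpanSingleton_apply]
      abel)
    simp [he, hg, ha, hd]

theorem exists_lie_apply_notMem_range (h : IsAdaptedFrame x w τ ι) (hdim : finrank K L = 8)
    (hw : ∀ X : L, ⁅X, w⁆ = 0) {X Y : L} (hXY : ⁅X, Y⁆ ∉ LinearMap.range ι) :
    ∃ a b, ⁅τ a, τ b⁆ ∉ LinearMap.range ι := by
  by_contra! hτ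
  obtain ⟨e, f, a, d, rfl⟩ := h.exists_eq_add (by simp [hdim]) X
  obtain ⟨e', f', a', d', rfl⟩ := h.exists_eq_add (by simp [hdim]) Y
  obtain ⟨c, hc⟩ := hτ a a'
  have hw' (Z : L) : ⁅w, Z⁆ = 0 := by rw [← lie_skew, hw, neg_zero]
  have hι (Z : L) (d : Fin 3 → K) : ⁅ι d, Z⁆ = 0 := by rw [← lie_skew, h.lie_apply_right, neg_zero]
  refine hXY ⟨e • a' - e' • a + c, ?_⟩
  simp only [lie_add, add_lie, lie_smul, smul_lie, lie_self, h.lie_apply, h.lie_apply_right, hw,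
    hw', hι, h.apply_lie, hc, map_add, map_sub, map_smul]
  module

theorem isSymplectic_of_lie_eq (h : IsAdaptedFrame x w τ ι) (hdim : finrank K L = 8) {X Y : L}
    (hXY : ⁅X, Y⁆ = w) : LieAlgebra.IsSymplectic K L := by
  have hw (Z : L) : ⁅Z, w⁆ = 0 := by rw [← hXY, h.lie_lie_eq_zero]
  obtain ⟨a, b, hab⟩ := h.exists_lie_apply_notMem_range hdim hw (X := X) (Y := Y) fun hmem =>
    h.notMem (Submodule.mem_sup_right (hXY ▸ hmem))
  obtain ⟨P, p, hp, hc⟩ := h.exists_isCentralExtensionBy_derivedFourCocycle hdim hw hab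
  exact hc.isSymplectic_of_ne_zero hp

end IsAdaptedFrame

end AdaptedFrames

section RankThree

variable {K L : Type*} [Field K] [LieRing L] [LieAlgebra K L]

theorem ad_ne_zero_of_finrank_range_ad_pos {x : L}
    (hx : 0 < finrank K (LinearMap.range (LieAlgebra.ad K L x))) : LieAlgebra.ad K L x ≠ 0 := by
  intro h0
  rw [h0, LinearMap.range_zero, finrank_bot] at hx
  exact hx.false

theorem exists_ad_section (x : L) :
    ∃ s : LinearMap.range (LieAlgebra.ad K L x) →ₗ[K] L, ∀ d, ⁅x, s d⁆ = d := by
  obtain ⟨s, hs⟩ := (LieAlgebra.ad K L x).rangeRestrict.exists_rightInverse_of_surjective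
    (LinearMap.range_rangeRestrict _)
  exact ⟨s, fun d => congrArg Subtype.val (LinearMap.congr_fun hs d)⟩

theorem isAdaptedFrame_of_linearEquiv (hnil : ∀ X Y Z : L, ⁅X, ⁅Y, Z⁆⁆ = 0) {x w : L}
    {R : Submodule K L} {s : R →ₗ[K] L} (hs : ∀ d, ⁅x, s d⁆ = d) (hxw : ⁅x, w⁆ = 0)
    (hw : w ∉ Submodule.span K {x} ⊔ R) {F : Type*} [AddCommGroup F] [Module K F] (φ : F ≃ₗ[K] R) :
    IsAdaptedFrame x w (s ∘ₗ φ.toLinearMap) (R.subtype ∘ₗ φ.toLinearMap) where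
  lie_lie_eq_zero := hnil
  lie_apply _ := hs _
  lie_eq_zero := hxw
  injective := R.injective_subtype.comp φ.injective
  notMem := by rwa [LinearEquiv.range_comp, Submodule.range_subtype]

variable [FiniteDimensional K L]

theorem two_mul_finrank_range_ad_lt_finrank (hnil : ∀ X Y Z : L, ⁅X, ⁅Y, Z⁆⁆ = 0) {x : L}
    (hx : LieAlgebra.ad K L x ≠ 0) :
    2 * finrank K (LinearMap.range (LieAlgebra.ad K L x)) < finrank K L := by
  have hlt : LinearMap.range (LieAlgebra.ad K L x) <
      LinearMap.ker (LieAlgebra.ad K L x) := by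
    refine SetLike.lt_iff_le_and_exists.2 ⟨?_, x, lie_self x, notMem_range_ad_of_ad_ne_zero hnil hx⟩
    rintro _ ⟨y, rfl⟩
    exact hnil x x y
  have hker := Submodule.finrank_lt_finrank_of_lt hlt
  have hrank := LinearMap.finrank_range_add_finrank_ker (LieAlgebra.ad K L x)
  omega

theorem exists_lie_eq_zero_notMem_span_sup_range (hdim : finrank K L = 8) {x : L}
    (hx : finrank K (LinearMap.range (LieAlgebra.ad K L x)) = 3) :
    ∃ w, ⁅x, w⁆ = 0 ∧
      w ∉ Submodule.span K {x} ⊔ LinearMap.range (LieAlgebra.ad K L x) := by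
  suffices ¬ LinearMap.ker (LieAlgebra.ad K L x) ≤
      Submodule.span K {x} ⊔ LinearMap.range (LieAlgebra.ad K L x) from
    SetLike.not_le_iff_exists.1 this
  intro hle
  have hker := Submodule.finrank_mono hle
  have hsup := Submodule.finrank_add_le_finrank_add_finrank (Submodule.span K {x})
    (LinearMap.range (LieAlgebra.ad K L x))
  have hspan : finrank K (Submodule.span K {x}) ≤ 1 :=
    (finrank_span_le_card {x}).trans_eq (by simp)
  have hrank := LinearMap.finrank_range_add_finrank_ker (LieAlgebra.ad K L x)
  omega

theorem isSymplectic_of_lie_notMem_range_ad (hdim : finrank K L = 8)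
    (hnil : ∀ X Y Z : L, ⁅X, ⁅Y, Z⁆⁆ = 0) {x : L}
    (hx : finrank K (LinearMap.range (LieAlgebra.ad K L x)) = 3) {X Y : L}
    (hXY : ⁅X, Y⁆ ∉ LinearMap.range (LieAlgebra.ad K L x)) :
    LieAlgebra.IsSymplectic K L := by
  obtain ⟨s, hs⟩ := exists_ad_section (K := K) x
  have hw : ⁅X, Y⁆ ∉ Submodule.span K {x} ⊔ LinearMap.range (LieAlgebra.ad K L x) := by
    refine fun hmem => hXY (mem_of_mem_span_singleton_sup ?_
      (ad_ne_zero_of_finrank_range_ad_pos (by omega)) (fun Z => hnil Z X Y) hmem)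
    rintro _ ⟨y, rfl⟩ Z
    exact hnil Z x y
  exact (isAdaptedFrame_of_linearEquiv hnil hs (hnil x X Y) hw
    (finBasisOfFinrankEq K _ hx).equivFun.symm).isSymplectic_of_lie_eq hdim rfl

theorem isSymplectic_or_nonempty_lieEquiv_of_lie_mem_range_ad (hdim : finrank K L = 8)
    (hnil : ∀ X Y Z : L, ⁅X, ⁅Y, Z⁆⁆ = 0) {x : L}
    (hx : finrank K (LinearMap.range (LieAlgebra.ad K L x)) = 3)
    (hrange : ∀ X Y : L, ⁅X, Y⁆ ∈ LinearMap.range (LieAlgebra.ad K L x)) :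
    LieAlgebra.IsSymplectic K L ∨ Nonempty (L ≃ₗ⁅K⁆ ExceptionalAlgebra K) := by
  obtain ⟨s, hs⟩ := exists_ad_section (K := K) x
  obtain ⟨w, hxw, hw⟩ := exists_lie_eq_zero_notMem_span_sup_range hdim hx
  let Q : End K (LinearMap.range (LieAlgebra.ad K L x)) :=
    (-(LieAlgebra.ad K L w : L →ₗ[K] L) ∘ₗ s).codRestrict _ fun d => neg_mem (hrange _ _)
  have hQ (d) : (Q d : L) = ⁅s d, w⁆ := lie_skew _ _
  obtain ⟨z, M, r, hM, hQM⟩ := exists_isShiftedNormalForm_add_smul_one hx Q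
  -- `⁅s d, x⁆ = -d`, so adding `r • x` to `w` removes the scalar part of `Q`.
  have hw' : w + r • x ∉
      Submodule.span K {x} ⊔ LinearMap.range (LieAlgebra.ad K L x) :=
    fun hmem => hw ((Submodule.add_mem_iff_left _ (Submodule.mem_sup_left
      (Submodule.smul_mem _ _ (Submodule.mem_span_singleton_self x)))).1 hmem)
  have hframe := isAdaptedFrame_of_linearEquiv hnil hs (by simp [hxw]) hw' z.equivFun.symm
  have hwM (a : Fin 3 → K) :
      ⁅s (z.equivFun.symm a), w + r • x⁆ = (z.equivFun.symm (M *ᵥ a) : L) := by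
    have hMa : toLin z z M (z.equivFun.symm a) = z.equivFun.symm (M *ᵥ a) := by
      refine z.equivFun.injective ?_
      rw [Basis.equivFun_apply, repr_toLin, ← Basis.equivFun_apply, LinearEquiv.apply_symm_apply,
        LinearEquiv.apply_symm_apply]
    have hQa : Q (z.equivFun.symm a) = z.equivFun.symm (M *ᵥ a) + r • z.equivFun.symm a := by
      rw [hQM, LinearMap.add_apply, hMa, LinearMap.smul_apply, Module.End.one_apply]
    rw [lie_add, lie_smul, ← hQ, hQa, ← lie_skew, hs]
    simp
  obtain ⟨P, hc⟩ := hframe.exists_isCentralExtensionBy_derivedThreeCocycle hdim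
    (by rwa [LinearEquiv.range_comp, Submodule.range_subtype]) hwM
  exact hc.isSymplectic_or_nonempty_lieEquiv hM

theorem isSymplectic_or_nonempty_lieEquiv (hdim : finrank K L = 8)
    (hnil : ∀ X Y Z : L, ⁅X, ⁅Y, Z⁆⁆ = 0) {x : L}
    (hx : 3 ≤ finrank K (LinearMap.range (LieAlgebra.ad K L x))) :
    LieAlgebra.IsSymplectic K L ∨ Nonempty (L ≃ₗ⁅K⁆ ExceptionalAlgebra K) := by
  have hx3 : finrank K (LinearMap.range (LieAlgebra.ad K L x)) = 3 := by
    have := two_mul_finrank_range_ad_lt_finrank hnil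
      (ad_ne_zero_of_finrank_range_ad_pos (K := K) (x := x) (by omega))
    omega
  by_cases hrange : ∀ X Y : L, ⁅X, Y⁆ ∈ LinearMap.range (LieAlgebra.ad K L x)
  · exact isSymplectic_or_nonempty_lieEquiv_of_lie_mem_range_ad hdim hnil hx3 hrange
  · push Not at hrange
    obtain ⟨X, Y, hXY⟩ := hrange
    exact Or.inl (isSymplectic_of_lie_notMem_range_ad hdim hnil hx3 hXY)

end RankThree

theorem lie_lie_eq_zero_of_lowerCentralSeries_two_eq_bot {K L : Type*} [CommRing K] [LieRing L]
    [LieAlgebra K L] (h : LieModule.lowerCentralSeries K L L 2 = ⊥) (X Y Z : L) :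
    ⁅X, ⁅Y, Z⁆⁆ = 0 := by
  rw [← LieSubmodule.mem_bot (R := K) (L := L), ← h, LieModule.lowerCentralSeries_succ,
    LieModule.lowerCentralSeries_succ]
  exact LieSubmodule.lie_mem_lie (LieSubmodule.mem_top _)
    (LieSubmodule.lie_mem_lie (LieSubmodule.mem_top _) (LieSubmodule.mem_top _))

theorem three_le_finrank_range_of_hasNilpotentJordanType {K V : Type*} [Field K] [AddCommGroup V]
    [Module K V] {T : V →ₗ[K] V} (h : T.HasNilpotentJordanType [2, 2, 2, 1, 1]) :
    3 ≤ finrank K (LinearMap.range T) := by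
  obtain ⟨-, -, b, hb⟩ := h
  have : FiniteDimensional K V := b.finiteDimensional_of_finite
  have h3 : 3 ≤ [2, 2, 2, 1, 1].length := by decide
  have hl : ∀ i : Fin 3, 1 < [2, 2, 2, 1, 1].get (Fin.castLE h3 i) := by decide +revert
  let v (i : Fin 3) : V := b ⟨Fin.castLE h3 i, ⟨1, hl i⟩⟩
  have hv : LinearIndependent K v :=
    b.linearIndependent.comp (fun i : Fin 3 => ⟨Fin.castLE h3 i, ⟨1, hl i⟩⟩) fun i j hij =>
      Fin.castLE_injective h3 (congrArg Sigma.fst hij)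
  have hmem (i : Fin 3) : v i ∈ LinearMap.range T :=
    ⟨b ⟨Fin.castLE h3 i, ⟨0, zero_lt_one.trans (hl i)⟩⟩, by rw [hb, dif_pos (hl i)]⟩
  calc 3 = finrank K (Submodule.span K (Set.range v)) := by
        rw [finrank_span_eq_card hv, Fintype.card_fin]
    _ ≤ finrank K (LinearMap.range T) :=
        Submodule.finrank_mono (Submodule.span_le.2 (Set.range_subset_iff.2 hmem))

theorem mainTheorem1_general {K L : Type*} [Field K] [LieRing L] [LieAlgebra K L]
    (hdim : finrank K L = 8) (hnil : LieModule.lowerCentralSeries K L L 2 = ⊥)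
    (hrank : ∃ x : L, 3 ≤ finrank K (LinearMap.range (LieAlgebra.ad K L x))) :
    LieAlgebra.IsSymplectic K L ↔ ¬ Nonempty (L ≃ₗ⁅K⁆ ExceptionalAlgebra K) := by
  obtain ⟨x, hx⟩ := hrank
  have : FiniteDimensional K L := FiniteDimensional.of_finrank_pos (by omega)
  refine ⟨fun hL ⟨φ⟩ => ExceptionalAlgebra.not_isSymplectic K (isSymplectic_of_lieEquiv φ hL),
    fun hL => (isSymplectic_or_nonempty_lieEquiv hdim ?_ hx).resolve_right hL⟩
  exact lie_lie_eq_zero_of_lowerCentralSeries_two_eq_bot hnil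

theorem mainTheorem1 (K : Type*) [RCLike K] (L : Type*) [LieRing L] [LieAlgebra K L]
    (hdim : Module.finrank K L = 8)
    (hnil : LieAlgebra.IsStepNilpotent K L 2)
    (hchar : LieAlgebra.IsCharacteristicSequence K L [2, 2, 2, 1, 1]) :
    LieAlgebra.IsSymplectic K L ↔ ¬ Nonempty (L ≃ₗ⁅K⁆ ExceptionalAlgebra K) := by
  obtain ⟨x, -, hx⟩ := hchar.1
  exact mainTheorem1_general hdim hnil.1 ⟨x, three_le_finrank_range_of_hasNilpotentJordanType hx⟩
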